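/- Let $\mathbb F_q\subseteq\mathbb F_{q^m}$ be finite fields, let $a,b$ be coprime positive integers, and let $\mathcal X_{a,b}$ be a $C_{a,b}$ curve over $\mathbb F_{q^m}$, i.e. a curve with an irreducible, affine, non-singular plane model $$\alpha_{0a}y^a+\alpha_{b0}x^b+\sum_{ai+bj<ab}\alpha_{ij}x^iy^j=0,\qquad \alpha_{0a},\alpha_{b0}\neq 0.$$ Let $P_\infty$ be its unique point at infinity, $\mathfrak g_{a,b}=\frac{(a-1)(b-1)}2$ its genus, and $\mathcal L(nP_\infty)$ the Riemann--Roch space of $nP_\infty$. A nonzero $f\in\bigcup_n\mathcal L(nP_\infty)$ is, uniquely, a linear combination of monomials $x^iy^j$ with $0\le j\le a-1$; its leading monomial $\mathrm{LT}(f)=x^\beta y^\alpha$ is the one with the largest weight $ai+bj$, and $\deg_{a,b}(f)=a\beta+b\alpha$. Put $$\mathcal R(f)=\mathrm{Span}_{\mathbb F_{q^m}}\{x^uy^v \mid 0\le u\le\beta+b-1,\ 0\le v\le a-1,\ \text{not both } u\ge\beta \text{ and } v\ge\alpha\}.$$ Let $s<s'$ be integers, let $g\in\mathcal L(s'P_\infty)$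 satisfy $\deg_{a,b}(g)=s'$, and let $\mathcal P\subseteq\mathcal X_{a,b}(\mathbb F_{q^m})$ be a set of rational points with $\mathcal P\cap\mathrm{Supp}(g)=\varnothing$. For a set $S$ of functions regular at the points of $\mathcal P$ write $\mathrm{Tr}(S)=\{(\mathrm{Tr}_{\mathbb F_{q^m}/\mathbb F_q}(f(P)))_{P\in\mathcal P}\mid f\in S\}\subseteq\mathbb F_q^{\mathcal P}$, and define $$\mathcal T_0(s,g)=\mathrm{Tr}\bigl(g^{-2}\cdot\mathcal L(2sP_\infty)\bigr),$$ $$\mathcal T_i(s,g)=\mathrm{Tr}\Bigl(g^{-(q^i+1)}\cdot\bigl(\mathcal R(g^{q^i-q^{i-1}+1})\cap\mathcal L(s(q^i+1)P_\infty)\bigr)\Bigr)\qquad(1\le i\le\lfloor m/2\rfloor).$$ Suppose that $i^*$ is the smallest $i\in\{0,\dots,\lfloor m/2\rfloor-1\}$ such that $$sq^{i}\ \ge\ (s'-s)(q^{i+1}-q^{i}+1)+2\mathfrak g_{a,b}-1 .$$ Then $$\mathcal T_{i^*}(s,g)\subseteq\mathcal T_{i^*+1}(s,g)\subseteq\dots\subseteq\mathcal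 T_{\lfloor m/2\rfloor}(s,g).$$ -/

import Mathlib

open scoped Polynomial

noncomputable section

/-- A place of the function field `F / K`, given by its valuation ring `O_P` with `K ⊆ O_P ⊊ F`.
For the function field of a curve, places are the closed points of the smooth projective model. -/
structure Place (K F : Type*) [Field K] [Field F] [Algebra K F] where
  ring : ValuationSubring F
  const_mem : ∀ c : K, algebraMap K F c ∈ ring
  ne_top : ring ≠ ⊤

namespace Place

variable {K F : Type*} [Field K] [Field F] [Algebra K F]

/-- `P.OrdGE f n` says that `v_P(f) ≥ n`, where `v_P` is the normalised valuation (`v_P(0) = ∞`):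
for `n ≥ 0` this is `f ∈ 𝔪_P ^ n`, and for `n = -k < 0` it is `f · 𝔪_P ^ k ⊆ O_P`. -/
def OrdGE (P : Place K F) (f : F) : ℤ → Prop
  | Int.ofNat n => ∃ z ∈ IsLocalRing.maximalIdeal P.ring ^ n, (z : F) = f
  | Int.negSucc n => ∀ z ∈ IsLocalRing.maximalIdeal P.ring ^ (n + 1), f * (z : F) ∈ P.ring

/-- The Riemann-Roch space `L(D) = {f ∣ f = 0 or (f) + D ≥ 0}`. -/
def riemannRoch (D : Place K F →₀ ℤ) : Set F :=
  {f | f = 0 ∨ ∀ P : Place K F, P.OrdGE f (-(D P))}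

/-- The place has degree one, i.e. `K → O_P / 𝔪_P` is onto. -/
def IsRational (P : Place K F) : Prop :=
  ∀ f ∈ P.ring, ∃ c : K, f - algebraMap K F c ∈ P.ring.nonunits

open Classical in
/-- The value `f(P)` at a rational place `P` of a function `f` regular at `P`: the constant `c` with
`f - c ∈ 𝔪_P` (and `0` if there is none). -/
def eval (P : Place K F) (f : F) : K :=
  if h : ∃ c : K, f - algebraMap K F c ∈ P.ring.nonunits then h.choose else 0

/-- The support of the divisor of a nonzero function `f`: the places where `f` is not a unit. -/
def support (K : Type*) {F : Type*} [Field K] [Field F] [Algebra K F] (f : F) :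
    Set (Place K F) :=
  {P | ¬ (f ∈ P.ring ∧ f⁻¹ ∈ P.ring)}

end Place

/-- An affine plane equation of a `C_{a,b}` curve. The coefficient of `x ^ i * y ^ j` in
`poly : K[X][Y]` is `(poly.coeff j).coeff i`. -/
structure CabCurve (K : Type*) [Field K] (a b : ℕ) where
  a_pos : 0 < a
  b_pos : 0 < b
  coprime : a.Coprime b
  poly : K[X][X]
  coeff_y : (poly.coeff a).coeff 0 ≠ 0
  coeff_x : (poly.coeff 0).coeff b ≠ 0
  coeff_other : ∀ i j : ℕ, (poly.coeff j).coeff i ≠ 0 →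
    (i = 0 ∧ j = a) ∨ (i = b ∧ j = 0) ∨ a * i + b * j < a * b
  irreducible : Irreducible poly
  /-- No point over the algebraic closure is a common zero of the equation and of its partial
  derivatives with respect to `x` and `y`. -/
  nonsingular : ∀ x y : AlgebraicClosure K,
    let p := poly.map (Polynomial.mapRingHom (algebraMap K (AlgebraicClosure K)))
    p.evalEval x y = 0 →
      (Polynomial.derivative (p.eval (Polynomial.C y))).eval x ≠ 0 ∨
        (Polynomial.derivative p).evalEval x y ≠ 0

namespace CabCurve

variable {K : Type*} [Field K] {a b : ℕ}

/-- The affine coordinate ring `K[x, y] / (f)`. -/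
abbrev CoordRing (C : CabCurve K a b) : Type _ := AdjoinRoot C.poly

instance (C : CabCurve K a b) : IsDomain C.CoordRing :=
  AdjoinRoot.isDomain_of_prime C.irreducible.prime

/-- The function field of the curve. -/
abbrev FunField (C : CabCurve K a b) : Type _ := FractionRing C.CoordRing

/-- The coordinate function `x`. -/
def x (C : CabCurve K a b) : C.FunField :=
  algebraMap C.CoordRing C.FunField (AdjoinRoot.of C.poly Polynomial.X)

/-- The coordinate function `y`. -/
def y (C : CabCurve K a b) : C.FunField :=
  algebraMap C.CoordRing C.FunField (AdjoinRoot.root C.poly)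

/-- `P` is a point at infinity, i.e. it does not lie on the affine model. -/
def IsAtInfinity (C : CabCurve K a b) (P : Place K C.FunField) : Prop :=
  ¬ (C.x ∈ P.ring ∧ C.y ∈ P.ring)

/-- `LT(f) = x ^ β * y ^ α`: up to a nonzero scalar `c`, `f` is `x ^ β * y ^ α` plus a combination
of monomials `x ^ i * y ^ j`, `j ≤ a - 1`, of smaller weighted degree `a * i + b * j`. -/
def HasLeadingTerm (C : CabCurve K a b) (f : C.FunField) (β α : ℕ) : Prop :=
  α < a ∧ ∃ c : K, c ≠ 0 ∧ f - c • (C.x ^ β * C.y ^ α) ∈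
    Submodule.span K {z : C.FunField | ∃ i j : ℕ, j < a ∧ a * i + b * j < a * β + b * α ∧
      z = C.x ^ i * C.y ^ j}

/-- `deg_{a,b}(f) = d`. -/
def HasWeightedDegree (C : CabCurve K a b) (f : C.FunField) (d : ℤ) : Prop :=
  ∃ β α : ℕ, C.HasLeadingTerm f β α ∧ ((a * β + b * α : ℕ) : ℤ) = d

/-- The space `R(f)` of remainders of the weighted division by `f`, where `LT(f) = x ^ β * y ^ α`:
the span of the `x ^ u * y ^ v` with `u ≤ β + b - 1`, `v ≤ a - 1`, not both `u ≥ β` and `v ≥ α`. -/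
def remainders (C : CabCurve K a b) (f : C.FunField) : Submodule K C.FunField :=
  Submodule.span K {z : C.FunField | ∃ β α u v : ℕ, C.HasLeadingTerm f β α ∧
    u < β + b ∧ v < a ∧ ¬ (β ≤ u ∧ α ≤ v) ∧ z = C.x ^ u * C.y ^ v}

/-- `L(n P)`. -/
def onePoint (C : CabCurve K a b) (P : Place K C.FunField) (n : ℤ) : Set C.FunField :=
  Place.riemannRoch (Finsupp.single P n)

/-- `Tr(S)`: the vectors `(Tr(f(P)))_{P ∈ pts}` with `f ∈ S`, where `Tr` is the trace of `K / k`. -/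
def traceCode (k : Type*) [Field k] [Algebra k K] (C : CabCurve K a b)
    (pts : Set (Place K C.FunField)) (S : Set C.FunField) : Set (pts → k) :=
  {w | ∃ f ∈ S, w = fun P => Algebra.trace k K (P.1.eval f)}

/-- The functions `f` that enter in `T_i(s, g)`: `L(2 s P∞)` for `i = 0`, and
`R(g ^ (q ^ i - q ^ (i - 1) + 1)) ∩ L(s (q ^ i + 1) P∞)` for `i ≥ 1`. -/
def numerators (C : CabCurve K a b) (Pinf : Place K C.FunField) (q : ℕ) (s : ℤ)
    (g : C.FunField) : ℕ → Set C.FunField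
  | 0 => C.onePoint Pinf (2 * s)
  | i + 1 => (C.remainders (g ^ (q ^ (i + 1) - q ^ i + 1)) : Set C.FunField) ∩
      C.onePoint Pinf (s * ((q : ℤ) ^ (i + 1) + 1))

/-- The trace code `T_i(s, g)`, of length `#pts` over `k = 𝔽_q`. -/
def T (k : Type*) [Field k] [Algebra k K] (C : CabCurve K a b) (Pinf : Place K C.FunField)
    (pts : Set (Place K C.FunField)) (q : ℕ) (s : ℤ) (g : C.FunField) (i : ℕ) : Set (pts → k) :=
  C.traceCode k pts {h | ∃ f ∈ C.numerators Pinf q s g i, h = (g ^ (q ^ i + 1))⁻¹ * f}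

/-- The genus `(a - 1) (b - 1) / 2` of a `C_{a,b}` curve (the division is exact, as `a` and `b` are
coprime). -/
def genus (a b : ℕ) : ℕ := (a - 1) * (b - 1) / 2

end CabCurve

end

/-!
A function `f / g ^ (q ^ i + 1)` can be rewritten with denominator `g ^ (q ^ (i + 1) + 1)` by
multiplying numerator and denominator with a power of `g`. Weighted division of the new numerator by
`g ^ (q ^ (i + 1) - q ^ i + 1)` leaves a remainder and a term `A / g ^ (q ^ i)`, where `A` has
smaller weighted degree than `g ^ (q ^ i)` because `f ∈ L(s (q ^ i + 1) P∞)` and `s < s'`.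
The trace of `A / g ^ (q ^ i)` at a rational point is that of its `q`-th power
`A ^ q * g / g ^ (q ^ (i + 1) + 1)`, to which the division applies again. Each round multiplies the
gap between the degrees of `g ^ (q ^ i)` and `A` by at least `q`, so that `A` vanishes after
finitely many rounds and only remainders are left
(`CabCurve.exists_remainder_trace_eval_eq`). A remainder has degree at most
`s' (q ^ (i + 1) - q ^ i + 1) + 2 * genus - 1`, and the numerical condition says that this is at
most `s (q ^ (i + 1) + 1)`; it passes from `istar` to all larger `i`.

The geometry enters through the description of `L(n P∞)` as the span of the reduced monomials of
weight at most `n` (`CabCurve.mem_onePoint_iff`), which has two ingredients.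

* At a place that does not contain both `x` and `y`, the terms `x ^ b` and `y ^ a` of the equation
  have the same value and dominate all others. As `a` and `b` are coprime, `x` and `y` have
  values `γ ^ a` and `γ ^ b` with `γ > 1`, and distinct reduced monomials have distinct values.
  So the valuation is the weighted degree, and the place is unique
  (`CabCurve.IsAtInfinity.exists_isWeightValuation`, `CabCurve.IsAtInfinity.unique`).
* A function regular at all other places is a polynomial in `x` and `y`. It lies in every valuation
  ring that contains `K[x, y]`, hence is integral over `K[x]` and over `K[y]`, so that both partial
  derivatives of the equation multiply it into `K[x, y]`
  (`aevalAeval_derivative_mul_mem_adjoin`). By nonsingularity and the Nullstellensatz these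
  derivatives generate the unit ideal of `K[x, y]`.
-/

/-! ### Places -/

namespace Place

variable {K F : Type*} [Field K] [Field F] [Algebra K F]

theorem ring_injective : Function.Injective (Place.ring : Place K F → ValuationSubring F) := by
  rintro ⟨A, _, _⟩ ⟨B, _, _⟩ h
  congr

theorem valuation_algebraMap (P : Place K F) {c : K} (hc : c ≠ 0) :
    P.ring.valuation (algebraMap K F c) = 1 := by
  refine le_antisymm ((P.ring.valuation_le_one_iff _).2 (P.const_mem c)) ?_
  have h := (P.ring.valuation_le_one_iff _).2 (P.const_mem c⁻¹)
  rw [map_inv₀, map_inv₀] at h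
  have hne : P.ring.valuation (algebraMap K F c) ≠ 0 := by simpa using hc
  exact (inv_le_one₀ (zero_lt_iff.2 hne)).1 h

/-- The value at `P` is characterised by `f - f(P) ∈ 𝔪_P`, as constants are units. -/
theorem eval_eq_of_sub_mem (P : Place K F) {f : F} {c : K}
    (h : f - algebraMap K F c ∈ P.ring.nonunits) : P.eval f = c := by
  have hex : ∃ c : K, f - algebraMap K F c ∈ P.ring.nonunits := ⟨c, h⟩
  have h' : f - algebraMap K F (P.eval f) ∈ P.ring.nonunits := by
    rw [eval, dif_pos hex]
    exact hex.choose_spec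
  by_contra hne
  rw [ValuationSubring.mem_nonunits_iff] at h h'
  have hlt := Valuation.map_sub_lt P.ring.valuation h h'
  rw [sub_sub_sub_cancel_left, ← map_sub, P.valuation_algebraMap (sub_ne_zero.2 hne)] at hlt
  exact lt_irrefl _ hlt

theorem IsRational.sub_eval_mem {P : Place K F} (hP : P.IsRational) {f : F} (hf : f ∈ P.ring) :
    f - algebraMap K F (P.eval f) ∈ P.ring.nonunits := by
  obtain ⟨c, hc⟩ := hP f hf
  rwa [P.eval_eq_of_sub_mem hc]

theorem IsRational.eval_add {P : Place K F} (hP : P.IsRational) {f g : F} (hf : f ∈ P.ring)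
    (hg : g ∈ P.ring) : P.eval (f + g) = P.eval f + P.eval g := by
  apply P.eval_eq_of_sub_mem
  have h1 := hP.sub_eval_mem hf
  have h2 := hP.sub_eval_mem hg
  rw [ValuationSubring.mem_nonunits_iff] at *
  rw [map_add, add_sub_add_comm]
  exact Valuation.map_add_lt _ h1 h2

theorem IsRational.eval_mul {P : Place K F} (hP : P.IsRational) {f g : F} (hf : f ∈ P.ring)
    (hg : g ∈ P.ring) : P.eval (f * g) = P.eval f * P.eval g := by
  apply P.eval_eq_of_sub_mem
  have h1 := hP.sub_eval_mem hf
  have h2 := hP.sub_eval_mem hg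
  rw [ValuationSubring.mem_nonunits_iff] at *
  have e : f * g - algebraMap K F (P.eval f * P.eval g) =
      (f - algebraMap K F (P.eval f)) * g +
        algebraMap K F (P.eval f) * (g - algebraMap K F (P.eval g)) := by
    rw [map_mul]; ring
  have hg1 := (P.ring.valuation_le_one_iff _).2 hg
  have hc1 := (P.ring.valuation_le_one_iff _).2 (P.const_mem (P.eval f))
  rw [e]
  refine Valuation.map_add_lt _ ?_ ?_
  · rw [map_mul]
    exact (mul_le_of_le_one_right' hg1).trans_lt h1
  · rw [map_mul]
    exact (mul_le_of_le_one_left' hc1).trans_lt h2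

theorem IsRational.eval_pow {P : Place K F} (hP : P.IsRational) {f : F} (hf : f ∈ P.ring)
    (n : ℕ) : P.eval (f ^ n) = P.eval f ^ n := by
  induction n with
  | zero =>
    apply P.eval_eq_of_sub_mem
    simp
  | succ n ih => rw [pow_succ, hP.eval_mul (pow_mem hf n) hf, ih, pow_succ]

theorem ordGE_zero_iff (P : Place K F) (f : F) : P.OrdGE f 0 ↔ f ∈ P.ring := by
  change (∃ z ∈ IsLocalRing.maximalIdeal P.ring ^ 0, (z : F) = f) ↔ _
  simp

theorem ordGE_neg_natCast_iff (P : Place K F) (f : F) (n : ℕ) :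
    P.OrdGE f (-(n : ℤ)) ↔ ∀ z ∈ IsLocalRing.maximalIdeal P.ring ^ n, f * (z : F) ∈ P.ring := by
  cases n with
  | zero =>
    rw [Nat.cast_zero, neg_zero, ordGE_zero_iff]
    refine ⟨fun h z _ => mul_mem h z.2, fun h => ?_⟩
    simpa using h 1 (by simp)
  | succ n => exact Iff.rfl

/-- If every nonzero value is a power of `γ > 1`, then `v_P(f) ≥ -n` means `|f|_P ≤ γ ^ n`. -/
theorem ordGE_neg_natCast_iff_valuation_le (P : Place K F) {γ : P.ring.ValueGroup} (hγ : 1 < γ)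
    (hval : ∀ z : F, z ≠ 0 → ∃ k : ℤ, P.ring.valuation z = γ ^ k) {t : F}
    (ht : P.ring.valuation t = γ⁻¹) (f : F) (n : ℕ) :
    P.OrdGE f (-(n : ℤ)) ↔ P.ring.valuation f ≤ γ ^ n := by
  have hγ0 : γ ≠ 0 := (zero_lt_one.trans hγ).ne'
  have ht0 : t ≠ 0 := fun h => hγ0 (by simpa [h, eq_comm] using ht)
  have ht1 : P.ring.valuation t < 1 := ht ▸ inv_lt_one_of_one_lt₀ hγ
  have htm : t ∈ P.ring := (P.ring.valuation_le_one_iff _).1 ht1.le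
  have hle : IsLocalRing.maximalIdeal P.ring ≤ Ideal.span {⟨t, htm⟩} := by
    intro z hz
    rw [Ideal.mem_span_singleton]
    by_cases hz0 : (z : F) = 0
    · exact (Subtype.ext hz0 : z = 0) ▸ dvd_zero _
    obtain ⟨k, hk⟩ := hval z hz0
    have hz1 := (P.ring.valuation_lt_one_iff z).1 hz
    have hk0 : k < 0 := (zpow_lt_one_iff_right₀ hγ).1 (hk ▸ hz1)
    have hzt : P.ring.valuation (z / t) ≤ 1 := by
      rw [map_div₀, hk, ht, div_inv_eq_mul, ← zpow_add_one₀ hγ0]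
      exact (zpow_le_one_iff_right₀ hγ).2 (by lia)
    refine ⟨⟨z / t, (P.ring.valuation_le_one_iff _).1 hzt⟩, Subtype.ext ?_⟩
    change (z : F) = t * (z / t)
    field_simp
  have hmem : ∀ z : F, z ∈ P.ring ↔ P.ring.valuation z ≤ 1 := fun z =>
    (P.ring.valuation_le_one_iff z).symm
  rw [ordGE_neg_natCast_iff]
  constructor
  · intro h
    have h1 := h (⟨t, htm⟩ ^ n) (Ideal.pow_mem_pow
      ((P.ring.valuation_lt_one_iff ⟨t, htm⟩).2 ht1) n)
    rw [hmem, map_mul] at h1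
    change P.ring.valuation f * P.ring.valuation (t ^ n) ≤ 1 at h1
    rw [map_pow, ht, inv_pow] at h1
    exact (mul_inv_le_iff₀ (pow_pos (zero_lt_one.trans hγ) n)).1 h1 |>.trans_eq (one_mul _)
  · intro h z hz
    have hz' := Ideal.pow_right_mono hle n hz
    rw [Ideal.span_singleton_pow, Ideal.mem_span_singleton] at hz'
    obtain ⟨w, rfl⟩ := hz'
    have hw := (hmem w).1 w.2
    rw [hmem]
    change P.ring.valuation (f * (t ^ n * (w : F))) ≤ 1
    rw [map_mul, map_mul, map_pow, ht, inv_pow, ← mul_assoc]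
    exact mul_le_one' ((mul_inv_le_iff₀ (pow_pos (zero_lt_one.trans hγ) n)).2
      (h.trans_eq (one_mul _).symm)) hw

end Place

noncomputable section

namespace CabCurve

variable {K : Type*} [Field K] {a b : ℕ}

/-! ### The weight filtration of the affine coordinate ring -/

/-- The affine coordinate ring `K[x, y]`, as a subalgebra of the function field. -/
def affineRing (C : CabCurve K a b) : Subalgebra K C.FunField :=
  Algebra.adjoin K {C.x, C.y}

/-- The functions of weight less than `n`, i.e. the span of the reduced monomials `x ^ i * y ^ j`,
`j < a`, with `a * i + b * j < n`. -/
def weightLT (C : CabCurve K a b) (n : ℕ) : Submodule K C.FunField :=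
  Submodule.span K {z : C.FunField | ∃ i j : ℕ, j < a ∧ a * i + b * j < n ∧
    z = C.x ^ i * C.y ^ j}

variable (C : CabCurve K a b)

theorem x_mem_affineRing : C.x ∈ C.affineRing := Algebra.subset_adjoin (by simp)

theorem y_mem_affineRing : C.y ∈ C.affineRing := Algebra.subset_adjoin (by simp)

theorem monomial_mem_affineRing (i j : ℕ) : C.x ^ i * C.y ^ j ∈ C.affineRing :=
  mul_mem (pow_mem C.x_mem_affineRing i) (pow_mem C.y_mem_affineRing j)

theorem aevalAeval_x_y (p : K[X][X]) :
    Polynomial.aevalAeval C.x C.y p =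
      algebraMap C.CoordRing C.FunField (AdjoinRoot.mk C.poly p) := by
  have h : (Polynomial.aevalAeval C.x C.y : K[X][X] →ₐ[K] C.FunField).toRingHom =
      (algebraMap C.CoordRing C.FunField).comp (AdjoinRoot.mk C.poly) := by
    ext c
    · simp
      rfl
    · simp [x]
    · simp [y]
  exact congr($h p)

theorem _root_.Polynomial.aevalAeval_mem_adjoin {R A : Type*} [CommRing R] [CommRing A]
    [Algebra R A] (u t : A) (p : R[X][X]) :
    Polynomial.aevalAeval u t p ∈ Algebra.adjoin R {u, t} := by
  have hu : u ∈ Algebra.adjoin R {u, t} := Algebra.subset_adjoin (by simp)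
  have ht : t ∈ Algebra.adjoin R {u, t} := Algebra.subset_adjoin (by simp)
  induction p using Polynomial.induction_on' with
  | add p q hp hq => rw [map_add]; exact add_mem hp hq
  | monomial j p =>
    induction p using Polynomial.induction_on' with
    | add p q hp hq => rw [map_add, map_add]; exact add_mem hp hq
    | monomial i c =>
      have : Polynomial.aevalAeval u t (Polynomial.monomial j (Polynomial.monomial i c)) =
          algebraMap R A c * (u ^ i * t ^ j) := by
        simp [mul_assoc]
      rw [this]
      exact mul_mem (Subalgebra.algebraMap_mem _ c) (mul_mem (pow_mem hu i) (pow_mem ht j))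

theorem aevalAeval_mem_affineRing (p : K[X][X]) :
    Polynomial.aevalAeval C.x C.y p ∈ C.affineRing :=
  Polynomial.aevalAeval_mem_adjoin _ _ p

theorem aevalAeval_poly : Polynomial.aevalAeval C.x C.y C.poly = 0 := by
  rw [aevalAeval_x_y, AdjoinRoot.mk_self, map_zero]

theorem exists_div_eq (z : C.FunField) :
    ∃ r ∈ C.affineRing, ∃ t ∈ C.affineRing, t ≠ 0 ∧ z = r / t := by
  obtain ⟨r, t, ht, rfl⟩ := IsFractionRing.div_surjective (A := C.CoordRing) z
  obtain ⟨p, rfl⟩ := AdjoinRoot.mk_surjective r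
  obtain ⟨p', rfl⟩ := AdjoinRoot.mk_surjective t
  refine ⟨_, C.aevalAeval_mem_affineRing p, _, C.aevalAeval_mem_affineRing p', ?_, ?_⟩
  · rw [aevalAeval_x_y]
    exact (IsFractionRing.to_map_eq_zero_iff (K := C.FunField)).not.2 (nonZeroDivisors.ne_zero ht)
  · rw [aevalAeval_x_y, aevalAeval_x_y]

theorem weightLT_mono {m n : ℕ} (h : m ≤ n) : C.weightLT m ≤ C.weightLT n :=
  Submodule.span_mono fun _ ⟨i, j, hj, hw, hz⟩ => ⟨i, j, hj, hw.trans_le h, hz⟩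

theorem weightLT_zero : C.weightLT 0 = ⊥ := by
  rw [weightLT, Submodule.span_eq_bot]
  rintro _ ⟨i, j, _, h, _⟩
  exact absurd h (Nat.not_lt_zero _)

theorem weightLT_le_affineRing (n : ℕ) : C.weightLT n ≤ Subalgebra.toSubmodule C.affineRing := by
  rw [weightLT, Submodule.span_le]
  rintro _ ⟨i, j, _, _, rfl⟩
  exact C.monomial_mem_affineRing i j

theorem one_mem_weightLT : (1 : C.FunField) ∈ C.weightLT 1 :=
  Submodule.subset_span ⟨0, 0, C.a_pos, by simp, by simp⟩

/-- A bivariate polynomial whose monomials have weight less than `n ≤ a * b` takes a value in the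
weight filtration: such monomials are already reduced. -/
theorem aevalAeval_mem_weightLT {n : ℕ} (hn : n ≤ a * b) (p : K[X][X])
    (hp : ∀ i j, (p.coeff j).coeff i ≠ 0 → a * i + b * j < n) :
    Polynomial.aevalAeval C.x C.y p ∈ C.weightLT n := by
  have e : Polynomial.aevalAeval C.x C.y p =
      ∑ j ∈ p.support, ∑ i ∈ (p.coeff j).support, (p.coeff j).coeff i • (C.x ^ i * C.y ^ j) := by
    conv_lhs => rw [p.as_sum_support, map_sum]
    refine Finset.sum_congr rfl fun j _ => ?_
    conv_lhs => rw [(p.coeff j).as_sum_support, map_sum, map_sum]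
    refine Finset.sum_congr rfl fun i _ => ?_
    simp [Algebra.smul_def, mul_assoc]
  rw [e]
  refine Submodule.sum_mem _ fun j _ => Submodule.sum_mem _ fun i hi => Submodule.smul_mem _ _ ?_
  have hw := hp i j (Polynomial.mem_support_iff.1 hi)
  refine Submodule.subset_span ⟨i, j, ?_, hw, rfl⟩
  have : b * j < b * a := by rw [mul_comm b a]; lia
  exact lt_of_mul_lt_mul_left' this

/-- The equation of the curve: `y ^ a` is a nonzero multiple of `x ^ b`, up to smaller weight. -/
theorem exists_y_pow_sub_mem_weightLT :
    ∃ c : K, c ≠ 0 ∧ C.y ^ a - c • C.x ^ b ∈ C.weightLT (a * b) := by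
  set α := (C.poly.coeff a).coeff 0 with hα
  set β := (C.poly.coeff 0).coeff b with hβ
  have ha := C.a_pos
  have hb := C.b_pos
  have hα0 : α ≠ 0 := C.coeff_y
  have key := C.aevalAeval_mem_weightLT le_rfl
    (C.poly - Polynomial.monomial a (Polynomial.monomial 0 α) -
      Polynomial.monomial 0 (Polynomial.monomial b β)) (by
    intro i j hij
    simp only [Polynomial.coeff_sub, Polynomial.coeff_monomial] at hij
    by_contra hw
    by_cases h0 : (C.poly.coeff j).coeff i = 0
    · apply hij
      rcases eq_or_ne j a with rfl | hja
      · rcases eq_or_ne i 0 with rfl | hi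
        · exact absurd h0 C.coeff_y
        · simp [h0, ha.ne, Polynomial.coeff_C, hi]
      · rcases eq_or_ne j 0 with rfl | hj
        · rcases eq_or_ne i b with rfl | hi
          · exact absurd h0 C.coeff_x
          · simp [h0, hja.symm, hi.symm, Polynomial.coeff_monomial]
        · simp [h0, hja.symm, hj.symm]
    · rcases C.coeff_other i j h0 with ⟨rfl, rfl⟩ | ⟨rfl, rfl⟩ | h
      · simp [hα, ha.ne] at hij
      · simp [hβ, ha.ne'] at hij
      · exact hw h)
  rw [map_sub, map_sub, aevalAeval_poly] at key
  refine ⟨-(α⁻¹ * β), by simp [hα0, hβ, C.coeff_x], ?_⟩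
  have := Submodule.smul_mem _ (-α⁻¹) key
  convert this using 1
  have hα1 : algebraMap K C.FunField α ≠ 0 := by simpa using hα0
  simp [Algebra.smul_def]
  field_simp
  ring

theorem x_mul_mem_weightLT {n : ℕ} {w : C.FunField} (hw : w ∈ C.weightLT n) :
    C.x * w ∈ C.weightLT (n + a) := by
  induction hw using Submodule.span_induction with
  | zero => simp
  | add u w _ _ hu hw => rw [mul_add]; exact add_mem hu hw
  | smul c w _ hw => rw [mul_smul_comm]; exact Submodule.smul_mem _ c hw
  | mem w hw =>
    obtain ⟨i, j, hj, hlt, rfl⟩ := hw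
    exact Submodule.subset_span ⟨i + 1, j, hj, by rw [mul_add]; lia, by ring⟩

theorem x_pow_mul_mem_weightLT {n : ℕ} {w : C.FunField} (hw : w ∈ C.weightLT n) (i : ℕ) :
    C.x ^ i * w ∈ C.weightLT (n + a * i) := by
  induction i with
  | zero => simpa using hw
  | succ i ih =>
    rw [pow_succ', mul_assoc, mul_add, mul_one, ← add_assoc]
    exact C.x_mul_mem_weightLT ih

theorem y_mul_mem_weightLT {n : ℕ} {w : C.FunField} (hw : w ∈ C.weightLT n) :
    C.y * w ∈ C.weightLT (n + b) := by
  induction hw using Submodule.span_induction with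
  | zero => simp
  | add u w _ _ hu hw => rw [mul_add]; exact add_mem hu hw
  | smul c w _ hw => rw [mul_smul_comm]; exact Submodule.smul_mem _ c hw
  | mem w hw =>
    obtain ⟨i, j, hj, hlt, rfl⟩ := hw
    rcases Nat.lt_or_ge (j + 1) a with hj' | hj'
    · exact Submodule.subset_span ⟨i, j + 1, hj', by rw [mul_add]; lia, by ring⟩
    · -- here `j + 1 = a`, and the equation of the curve rewrites `y ^ a`
      have hja : j + 1 = a := by lia
      obtain ⟨c, -, hc⟩ := C.exists_y_pow_sub_mem_weightLT
      have hw : a * b + a * i < n + b := by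
        have : a * b = b * j + b := by rw [← hja]; ring
        lia
      have e : C.y * (C.x ^ i * C.y ^ j) =
          C.x ^ i * (C.y ^ a - c • C.x ^ b) + c • (C.x ^ (i + b) * C.y ^ 0) := by
        have hy : C.y * C.y ^ j = C.y ^ a := by rw [← pow_succ', hja]
        simp only [Algebra.smul_def]
        linear_combination C.x ^ i * hy
      rw [e]
      refine add_mem (C.weightLT_mono hw.le (C.x_pow_mul_mem_weightLT hc i))
        (Submodule.smul_mem _ c (Submodule.subset_span ⟨i + b, 0, C.a_pos, ?_, rfl⟩))
      rw [mul_add]; lia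

theorem monomial_mul_mem_weightLT {n : ℕ} {w : C.FunField} (hw : w ∈ C.weightLT n) (i j : ℕ) :
    C.x ^ i * C.y ^ j * w ∈ C.weightLT (n + (a * i + b * j)) := by
  have hy : C.y ^ j * w ∈ C.weightLT (n + b * j) := by
    induction j with
    | zero => simpa using hw
    | succ j ih =>
      rw [pow_succ', mul_assoc, mul_add, mul_one, ← add_assoc]
      exact C.y_mul_mem_weightLT ih
  have := C.x_pow_mul_mem_weightLT hy i
  rw [mul_assoc]
  exact C.weightLT_mono (by lia) this

theorem monomial_mem_weightLT (i j : ℕ) : C.x ^ i * C.y ^ j ∈ C.weightLT (a * i + b * j + 1) := by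
  have := C.monomial_mul_mem_weightLT C.one_mem_weightLT i j
  rw [mul_one] at this
  exact C.weightLT_mono (by lia) this

theorem mul_mem_weightLT {m n : ℕ} {z w : C.FunField} (hz : z ∈ C.weightLT m)
    (hw : w ∈ C.weightLT n) : z * w ∈ C.weightLT (m + n) := by
  induction hz using Submodule.span_induction with
  | zero => simp
  | add u z _ _ hu hz => rw [add_mul]; exact add_mem hu hz
  | smul c z _ hz => rw [smul_mul_assoc]; exact Submodule.smul_mem _ c hz
  | mem z hz =>
    obtain ⟨i, j, hj, hlt, rfl⟩ := hz
    exact C.weightLT_mono (by lia) (C.monomial_mul_mem_weightLT hw i j)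

theorem exists_mem_weightLT {z : C.FunField} (hz : z ∈ C.affineRing) : ∃ n, z ∈ C.weightLT n := by
  induction hz using Algebra.adjoin_induction with
  | mem z hz =>
    rcases hz with rfl | rfl
    · exact ⟨_, by simpa using C.monomial_mem_weightLT 1 0⟩
    · exact ⟨_, by simpa using C.monomial_mem_weightLT 0 1⟩
  | algebraMap c =>
    exact ⟨1, by simpa [Algebra.smul_def] using Submodule.smul_mem _ c C.one_mem_weightLT⟩
  | add z w _ _ hz hw =>
    obtain ⟨m, hm⟩ := hz
    obtain ⟨n, hn⟩ := hw
    exact ⟨max m n, add_mem (C.weightLT_mono (le_max_left m n) hm)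
      (C.weightLT_mono (le_max_right m n) hn)⟩
  | mul z w _ _ hz hw =>
    obtain ⟨m, hm⟩ := hz
    obtain ⟨n, hn⟩ := hw
    exact ⟨m + n, C.mul_mem_weightLT hm hn⟩

/-- Distinct reduced monomials have distinct weights. -/
theorem eq_and_eq_of_weight_eq (C : CabCurve K a b) {i j i' j' : ℕ} (hj : j < a) (hj' : j' < a)
    (h : a * i + b * j = a * i' + b * j') : i = i' ∧ j = j' := by
  have hmod : b * j ≡ b * j' [MOD a] := by
    have : a * i + b * j ≡ a * i' + b * j' [MOD a] := congrArg (· % a) h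
    simpa [Nat.ModEq, Nat.add_mod] using this
  have hjj : j = j' :=
    (Nat.ModEq.cancel_left_of_coprime C.coprime hmod).eq_of_lt_of_lt hj hj'
  subst hjj
  exact ⟨Nat.eq_of_mul_eq_mul_left C.a_pos (by lia), rfl⟩

theorem mem_weightLT_succ {n : ℕ} {z : C.FunField} (hz : z ∈ C.weightLT (n + 1)) :
    z ∈ C.weightLT n ∨ ∃ i j, j < a ∧ a * i + b * j = n ∧ ∃ c : K, c ≠ 0 ∧
      z - c • (C.x ^ i * C.y ^ j) ∈ C.weightLT n := by
  by_cases hex : ∃ i j, j < a ∧ a * i + b * j = n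
  · obtain ⟨i, j, hj, hn⟩ := hex
    have hle : C.weightLT (n + 1) ≤ Submodule.span K {C.x ^ i * C.y ^ j} ⊔ C.weightLT n := by
      refine Submodule.span_le.2 ?_
      rintro _ ⟨i', j', hj', hlt, rfl⟩
      rcases Nat.lt_succ_iff_lt_or_eq.1 hlt with hlt | heq
      · exact Submodule.mem_sup_right (Submodule.subset_span ⟨i', j', hj', hlt, rfl⟩)
      · obtain ⟨rfl, rfl⟩ := C.eq_and_eq_of_weight_eq hj' hj (heq.trans hn.symm)
        exact Submodule.mem_sup_left (Submodule.mem_span_singleton_self _)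
    obtain ⟨u, hu, w, hw, rfl⟩ := Submodule.mem_sup.1 (hle hz)
    obtain ⟨c, rfl⟩ := Submodule.mem_span_singleton.1 hu
    by_cases hc : c = 0
    · left; simpa [hc] using hw
    · right; exact ⟨i, j, hj, hn, c, hc, by simpa using hw⟩
  · left
    refine (Submodule.span_le.2 ?_ : C.weightLT (n + 1) ≤ C.weightLT n) hz
    rintro _ ⟨i', j', hj', hlt, rfl⟩
    refine Submodule.subset_span ⟨i', j', hj', ?_, rfl⟩
    rcases Nat.lt_succ_iff_lt_or_eq.1 hlt with hlt | heq
    · exact hlt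
    · exact absurd ⟨i', j', hj', heq⟩ hex

theorem exists_hasLeadingTerm {n : ℕ} {z : C.FunField} (hz : z ∈ C.weightLT n) (h0 : z ≠ 0) :
    ∃ β α, C.HasLeadingTerm z β α ∧ a * β + b * α < n := by
  induction n with
  | zero =>
    rw [weightLT_zero] at hz
    exact absurd ((Submodule.mem_bot K).1 hz) h0
  | succ n ih =>
    rcases C.mem_weightLT_succ hz with h | ⟨i, j, hj, rfl, c, hc, h⟩
    · obtain ⟨β, α, h1, h2⟩ := ih h
      exact ⟨β, α, h1, h2.trans n.lt_succ_self⟩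
    · exact ⟨i, j, ⟨hj, c, hc, h⟩, Nat.lt_succ_self _⟩

theorem HasLeadingTerm.mem_weightLT {C : CabCurve K a b} {z : C.FunField} {β α : ℕ}
    (h : C.HasLeadingTerm z β α) : z ∈ C.weightLT (a * β + b * α + 1) := by
  obtain ⟨hα, c, -, hc⟩ := h
  have h1 : c • (C.x ^ β * C.y ^ α) ∈ C.weightLT (a * β + b * α + 1) :=
    Submodule.smul_mem _ c (Submodule.subset_span ⟨β, α, hα, Nat.lt_succ_self _, rfl⟩)
  have := add_mem (C.weightLT_mono (Nat.le_succ _) hc) h1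
  rwa [sub_add_cancel] at this

end CabCurve

end

noncomputable section

namespace CabCurve

variable {K : Type*} [Field K] {a b : ℕ}

/-! ### Valuations at infinity -/

/-- `v` is trivial on constants and `v(x) = γ ^ a`, `v(y) = γ ^ b` with `γ > 1`, so that it measures
the weighted degree in powers of `γ`. -/
structure IsWeightValuation (C : CabCurve K a b) {Γ : Type*} [LinearOrderedCommGroupWithZero Γ]
    (v : Valuation C.FunField Γ) (γ : Γ) : Prop where
  one_lt : 1 < γ
  map_const : ∀ c : K, c ≠ 0 → v (algebraMap K C.FunField c) = 1
  map_x : v C.x = γ ^ a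
  map_y : v C.y = γ ^ b

theorem _root_.Valuation.map_smul_of_const {F Γ : Type*} [Field F] [Algebra K F]
    [LinearOrderedCommGroupWithZero Γ] (v : Valuation F Γ)
    (hv : ∀ c : K, c ≠ 0 → v (algebraMap K F c) = 1) {c : K} (hc : c ≠ 0) (z : F) :
    v (c • z) = v z := by
  rw [Algebra.smul_def, map_mul, hv c hc, one_mul]

theorem _root_.Valuation.lt_of_mem_span {F Γ : Type*} [Field F] [Algebra K F]
    [LinearOrderedCommGroupWithZero Γ] (v : Valuation F Γ)
    (hv : ∀ c : K, c ≠ 0 → v (algebraMap K F c) = 1) {M : Γ} (hM : M ≠ 0) {S : Set F}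
    (hS : ∀ z ∈ S, v z < M) {z : F} (hz : z ∈ Submodule.span K S) : v z < M := by
  induction hz using Submodule.span_induction with
  | mem z hz => exact hS z hz
  | zero => rw [map_zero]; exact zero_lt_iff.2 hM
  | add z w _ _ hz hw => exact Valuation.map_add_lt v hz hw
  | smul c z _ hz =>
    by_cases hc : c = 0
    · rw [hc, zero_smul, map_zero]; exact zero_lt_iff.2 hM
    · rwa [v.map_smul_of_const hv hc]

variable {C : CabCurve K a b}

section IsWeightValuation

variable {Γ : Type*} [LinearOrderedCommGroupWithZero Γ] {v : Valuation C.FunField Γ} {γ : Γ}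

namespace IsWeightValuation

theorem ne_zero (hv : C.IsWeightValuation v γ) : γ ≠ 0 := (zero_lt_one.trans hv.one_lt).ne'

theorem map_monomial (hv : C.IsWeightValuation v γ) (i j : ℕ) :
    v (C.x ^ i * C.y ^ j) = γ ^ (a * i + b * j) := by
  rw [map_mul, map_pow, map_pow, hv.map_x, hv.map_y, pow_add, pow_mul, pow_mul]

theorem lt_of_mem_weightLT (hv : C.IsWeightValuation v γ) {n : ℕ} {z : C.FunField}
    (hz : z ∈ C.weightLT n) : v z < γ ^ n := by
  refine v.lt_of_mem_span hv.map_const (pow_ne_zero n hv.ne_zero) ?_ hz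
  rintro _ ⟨i, j, -, hlt, rfl⟩
  rw [hv.map_monomial]
  exact pow_lt_pow_right₀ hv.one_lt hlt

theorem map_of_hasLeadingTerm (hv : C.IsWeightValuation v γ) {z : C.FunField} {β α : ℕ}
    (h : C.HasLeadingTerm z β α) : v z = γ ^ (a * β + b * α) := by
  obtain ⟨-, c, hc, hz⟩ := h
  have h1 := hv.lt_of_mem_weightLT hz
  have h2 : v (c • (C.x ^ β * C.y ^ α)) = γ ^ (a * β + b * α) := by
    rw [v.map_smul_of_const hv.map_const hc, hv.map_monomial]
  rw [← h2] at h1 ⊢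
  have := Valuation.map_add_eq_of_lt_left v h1
  rwa [add_sub_cancel] at this

theorem le_of_mem_weightLT_succ (hv : C.IsWeightValuation v γ) {n : ℕ} {z : C.FunField}
    (hz : z ∈ C.weightLT (n + 1)) : v z ≤ γ ^ n := by
  by_cases hz0 : z = 0
  · simp [hz0]
  obtain ⟨β, α, hlt, hw⟩ := C.exists_hasLeadingTerm hz hz0
  rw [hv.map_of_hasLeadingTerm hlt]
  exact pow_le_pow_right₀ hv.one_lt.le (Nat.lt_succ_iff.1 hw)

/-- On the affine ring the weight filtration is the valuation filtration. -/
theorem mem_weightLT_iff (hv : C.IsWeightValuation v γ) {z : C.FunField} (hz : z ∈ C.affineRing)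
    {n : ℕ} : z ∈ C.weightLT n ↔ v z < γ ^ n := by
  refine ⟨hv.lt_of_mem_weightLT, fun h => ?_⟩
  by_cases h0 : z = 0
  · rw [h0]; exact zero_mem _
  obtain ⟨N, hN⟩ := C.exists_mem_weightLT hz
  obtain ⟨β, α, hlt, -⟩ := C.exists_hasLeadingTerm hN h0
  rw [hv.map_of_hasLeadingTerm hlt] at h
  exact C.weightLT_mono ((pow_lt_pow_iff_right₀ hv.one_lt).1 h) hlt.mem_weightLT

/-- Every nonzero function has a well-defined weighted degree `m - n`, which its value at infinity
recovers. -/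
theorem exists_eq_div (C : CabCurve K a b) {z : C.FunField} (hz : z ≠ 0) :
    ∃ m n : ℕ, ∀ {Γ : Type _} [LinearOrderedCommGroupWithZero Γ] {v : Valuation C.FunField Γ}
      {γ : Γ}, C.IsWeightValuation v γ → v z = γ ^ m / γ ^ n := by
  obtain ⟨r, hr, t, ht, ht0, rfl⟩ := C.exists_div_eq z
  obtain ⟨M, hM⟩ := C.exists_mem_weightLT hr
  obtain ⟨N, hN⟩ := C.exists_mem_weightLT ht
  obtain ⟨β, α, h, -⟩ := C.exists_hasLeadingTerm hM (by rintro rfl; simp at hz)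
  obtain ⟨β', α', h', -⟩ := C.exists_hasLeadingTerm hN ht0
  refine ⟨a * β + b * α, a * β' + b * α', fun hv => ?_⟩
  rw [map_div₀, hv.map_of_hasLeadingTerm h, hv.map_of_hasLeadingTerm h']

end IsWeightValuation

end IsWeightValuation

/-- A place that does not contain both coordinate functions gives a weight valuation: the two
extreme terms `y ^ a` and `x ^ b` of the equation have the same value, larger than that of all
other terms, and `a`, `b` are coprime. -/
theorem IsAtInfinity.exists_isWeightValuation {P : Place K C.FunField} (hP : C.IsAtInfinity P) :
    ∃ γ, C.IsWeightValuation P.ring.valuation γ ∧ ∃ t, P.ring.valuation t = γ⁻¹ := by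
  set v := P.ring.valuation with hv
  have ha := C.a_pos
  have hb := C.b_pos
  have hconst : ∀ c : K, c ≠ 0 → v (algebraMap K C.FunField c) = 1 :=
    fun c hc => P.valuation_algebraMap hc
  obtain ⟨c, hc0, hc⟩ := C.exists_y_pow_sub_mem_weightLT
  have hM1 : 1 < max (v C.x ^ b) (v C.y ^ a) := by
    rw [lt_max_iff]
    by_contra! h
    exact hP ⟨(P.ring.valuation_le_one_iff _).1 ((pow_le_one_iff hb.ne').1 h.1),
      (P.ring.valuation_le_one_iff _).1 ((pow_le_one_iff ha.ne').1 h.2)⟩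
  have hlt : v (C.y ^ a - c • C.x ^ b) < max (v C.x ^ b) (v C.y ^ a) := by
    set M := max (v C.x ^ b) (v C.y ^ a) with hM
    refine v.lt_of_mem_span hconst (zero_lt_one.trans hM1).ne' ?_ hc
    rintro _ ⟨i, j, -, hw, rfl⟩
    refine lt_of_pow_lt_pow_left₀ (a * b) zero_le ?_
    calc v (C.x ^ i * C.y ^ j) ^ (a * b) = (v C.x ^ b) ^ (a * i) * (v C.y ^ a) ^ (b * j) := by
          rw [map_mul, map_pow, map_pow, mul_pow, ← pow_mul, ← pow_mul, ← pow_mul, ← pow_mul]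
          congr 2 <;> ring
      _ ≤ M ^ (a * i) * M ^ (b * j) :=
          mul_le_mul' (pow_le_pow_left' (le_max_left _ _) _) (pow_le_pow_left' (le_max_right _ _) _)
      _ = M ^ (a * i + b * j) := (pow_add _ _ _).symm
      _ < M ^ (a * b) := pow_lt_pow_right₀ hM1 hw
  have hxb : v (c • C.x ^ b) = v C.x ^ b := by rw [v.map_smul_of_const hconst hc0, map_pow]
  have heq : v C.x ^ b = v C.y ^ a := by
    by_contra hne
    rcases lt_or_gt_of_ne hne with h | h
    · rw [Valuation.map_sub_eq_of_lt_left v (by rwa [hxb, map_pow]), map_pow, max_eq_right h.le]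
        at hlt
      exact lt_irrefl _ hlt
    · rw [Valuation.map_sub_eq_of_lt_right v (by rwa [hxb, map_pow]), hxb, max_eq_left h.le] at hlt
      exact lt_irrefl _ hlt
  rw [heq, max_self] at hM1
  have hx0 : v C.x ≠ 0 := by
    intro h
    rw [← heq, h, zero_pow hb.ne'] at hM1
    exact not_lt_zero hM1
  have hy0 : v C.y ≠ 0 := by
    intro h
    rw [h, zero_pow ha.ne'] at hM1
    exact not_lt_zero hM1
  -- `γ = v(x) ^ r * v(y) ^ l` for a Bézout relation `a * r + b * l = 1`
  set r := Nat.gcdA a b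
  set l := Nat.gcdB a b
  have hbez : (a : ℤ) * r + b * l = 1 := by
    rw [← Nat.gcd_eq_gcd_ab, Nat.Coprime.gcd_eq_one C.coprime, Nat.cast_one]
  have hxa : v C.x = (v C.x ^ r * v C.y ^ l) ^ a := by
    have e : (v C.y ^ l) ^ a = v C.x ^ ((b : ℤ) * l) := by
      rw [zpow_mul, zpow_natCast, heq, ← zpow_natCast, ← zpow_natCast, ← zpow_mul, ← zpow_mul,
        mul_comm]
    rw [mul_pow, e, ← zpow_natCast, ← zpow_mul, ← zpow_add₀ hx0, mul_comm r, hbez, zpow_one]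
  have hyb : v C.y = (v C.x ^ r * v C.y ^ l) ^ b := by
    have e : (v C.x ^ r) ^ b = v C.y ^ ((a : ℤ) * r) := by
      rw [zpow_mul, zpow_natCast, ← heq, ← zpow_natCast, ← zpow_natCast, ← zpow_mul, ← zpow_mul,
        mul_comm]
    rw [mul_pow, e, ← zpow_natCast, ← zpow_mul, ← zpow_add₀ hy0, mul_comm l, hbez, zpow_one]
  refine ⟨v C.x ^ r * v C.y ^ l, ⟨?_, hconst, hxa, hyb⟩, (C.x ^ r * C.y ^ l)⁻¹, by simp⟩
  refine lt_of_pow_lt_pow_left₀ b zero_le ?_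
  rw [← hyb, one_pow]
  exact (one_lt_pow_iff ha.ne').1 hM1

/-- The point at infinity is unique. -/
theorem IsAtInfinity.unique {P Q : Place K C.FunField} (hP : C.IsAtInfinity P)
    (hQ : C.IsAtInfinity Q) : P = Q := by
  obtain ⟨γ, hγ, -⟩ := hP.exists_isWeightValuation
  obtain ⟨δ, hδ, -⟩ := hQ.exists_isWeightValuation
  refine Place.ring_injective (SetLike.ext fun z => ?_)
  by_cases hz : z = 0
  · rw [hz]; exact ⟨fun _ => zero_mem _, fun _ => zero_mem _⟩
  obtain ⟨m, n, h⟩ := IsWeightValuation.exists_eq_div C hz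
  rw [← P.ring.valuation_le_one_iff, ← Q.ring.valuation_le_one_iff, h hγ, h hδ,
    div_le_one₀ (pow_pos (zero_lt_one.trans hγ.one_lt) n),
    div_le_one₀ (pow_pos (zero_lt_one.trans hδ.one_lt) n),
    pow_le_pow_iff_right₀ hγ.one_lt, pow_le_pow_iff_right₀ hδ.one_lt]

theorem affineRing_le_of_not_isAtInfinity {P : Place K C.FunField} (hP : ¬ C.IsAtInfinity P)
    {z : C.FunField} (hz : z ∈ C.affineRing) : z ∈ P.ring := by
  obtain ⟨hx, hy⟩ := not_not.1 hP
  induction hz using Algebra.adjoin_induction with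
  | mem z hz => rcases hz with rfl | rfl <;> assumption
  | algebraMap c => exact P.const_mem c
  | add z w _ _ hz hw => exact add_mem hz hw
  | mul z w _ _ hz hw => exact mul_mem hz hw

theorem ordGE_neg_natCast_iff_of_isAtInfinity {P : Place K C.FunField}
    {γ : P.ring.ValueGroup} (hγ : C.IsWeightValuation P.ring.valuation γ) {t : C.FunField}
    (ht : P.ring.valuation t = γ⁻¹) (f : C.FunField) (n : ℕ) :
    P.OrdGE f (-(n : ℤ)) ↔ P.ring.valuation f ≤ γ ^ n := by
  refine P.ordGE_neg_natCast_iff_valuation_le hγ.one_lt (fun z hz => ?_) ht f n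
  obtain ⟨m, n, h⟩ := IsWeightValuation.exists_eq_div C hz
  exact ⟨m - n, by rw [h hγ, zpow_sub₀ hγ.ne_zero, zpow_natCast, zpow_natCast]⟩

/-! ### Weighted division -/

/-- A function of the same weight as a reduced monomial is a multiple of it, up to smaller
weight. -/
theorem exists_smul_sub_mem_weightLT {i j : ℕ} (hj : j < a) {w : C.FunField}
    (hw : w ∈ C.weightLT (a * i + b * j + 1)) (hw' : w ∉ C.weightLT (a * i + b * j)) :
    ∃ c : K, C.x ^ i * C.y ^ j - c • w ∈ C.weightLT (a * i + b * j) := by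
  rcases C.mem_weightLT_succ hw with h | ⟨i', j', hj', heq, c, hc, h⟩
  · exact absurd h hw'
  · obtain ⟨rfl, rfl⟩ := C.eq_and_eq_of_weight_eq hj' hj heq
    refine ⟨c⁻¹, ?_⟩
    have := Submodule.smul_mem _ (-c⁻¹) h
    convert this using 1
    rw [smul_sub, smul_smul, neg_mul, inv_mul_cancel₀ hc]
    module

/-- Weighted division by `G`, whose leading monomial has weight `D`: the quotient has weight less
than `n - D` (so it vanishes if `n ≤ D`). The monomials outside the span of the remainders are the
leading monomials, up to scalars, of `x ^ (u - β) * y ^ (v - α) * G`, if `u ≥ β` and `v ≥ α`, and of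
`x ^ (u - β - b) * y ^ (a + v - α) * G`, if `u ≥ β + b` and `v < α`. -/
theorem exists_eq_mul_add_remainder {Γ : Type*} [LinearOrderedCommGroupWithZero Γ]
    {v : Valuation C.FunField Γ} {γ : Γ} (hv : C.IsWeightValuation v γ) {G : C.FunField} {β α : ℕ}
    (hG : C.HasLeadingTerm G β α) {n : ℕ} {z : C.FunField} (hz : z ∈ C.weightLT n) :
    ∃ A ∈ C.weightLT (n - (a * β + b * α)), ∃ r ∈ C.remainders G, z = G * A + r := by
  have hGw := hG.mem_weightLT
  have hGR := C.weightLT_le_affineRing _ hGw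
  -- a reduced monomial is the leading monomial, up to a scalar, of each monomial multiple of `G`
  -- of the same weight
  have hstep : ∀ i j i' j' : ℕ, j < a →
      a * i + b * j = a * i' + b * j' + (a * β + b * α) → ∃ c : K,
      C.x ^ i * C.y ^ j - c • (C.x ^ i' * C.y ^ j' * G) ∈ C.weightLT (a * i + b * j) := by
    intro i j i' j' hj he
    have hR : C.x ^ i' * C.y ^ j' * G ∈ C.affineRing :=
      mul_mem (C.monomial_mem_affineRing i' j') hGR
    have hval : v (C.x ^ i' * C.y ^ j' * G) = γ ^ (a * i + b * j) := by
      rw [map_mul, hv.map_monomial, hv.map_of_hasLeadingTerm hG, ← pow_add, he]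
    refine exists_smul_sub_mem_weightLT hj ?_ ?_
    · rw [hv.mem_weightLT_iff hR, hval]
      exact pow_lt_pow_right₀ hv.one_lt (Nat.lt_succ_self _)
    · rw [hv.mem_weightLT_iff hR, hval]
      exact lt_irrefl _
  -- so it can be divided by `G` if all functions of smaller weight can
  have hmulti : ∀ i j i' j' : ℕ, j < a →
      a * i + b * j = a * i' + b * j' + (a * β + b * α) →
      (∀ w ∈ C.weightLT (a * i + b * j), ∃ A ∈ C.weightLT (a * i + b * j - (a * β + b * α)),
        ∃ r ∈ C.remainders G, w = G * A + r) →
      ∃ A ∈ C.weightLT (a * i + b * j + 1 - (a * β + b * α)), ∃ r ∈ C.remainders G,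
        C.x ^ i * C.y ^ j = G * A + r := by
    intro i j i' j' hj he ih
    obtain ⟨c, hc⟩ := hstep i j i' j' hj he
    obtain ⟨A, hA, r, hr, h⟩ := ih _ hc
    refine ⟨A + c • (C.x ^ i' * C.y ^ j'), add_mem (C.weightLT_mono (by lia) hA)
      (Submodule.smul_mem _ c (C.weightLT_mono (by lia) (C.monomial_mem_weightLT i' j'))),
      r, hr, ?_⟩
    rw [sub_eq_iff_eq_add] at h
    rw [h]
    simp only [Algebra.smul_def]
    ring
  induction n generalizing z with
  | zero =>
    rw [weightLT_zero, Submodule.mem_bot] at hz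
    exact ⟨0, zero_mem _, 0, zero_mem _, by simp [hz]⟩
  | succ n ih =>
    rcases C.mem_weightLT_succ hz with h | ⟨i, j, hj, rfl, c, -, h⟩
    · obtain ⟨A, hA, r, hr, he⟩ := ih h
      exact ⟨A, C.weightLT_mono (by lia) hA, r, hr, he⟩
    · obtain ⟨A, hA, r, hr, he⟩ := ih h
      suffices hmon : ∃ A ∈ C.weightLT (a * i + b * j + 1 - (a * β + b * α)),
          ∃ r ∈ C.remainders G, C.x ^ i * C.y ^ j = G * A + r by
        obtain ⟨A', hA', r', hr', he'⟩ := hmon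
        refine ⟨A + c • A', add_mem (C.weightLT_mono (by lia) hA) (Submodule.smul_mem _ c hA'),
          r + c • r', add_mem hr (Submodule.smul_mem _ c hr'), ?_⟩
        rw [sub_eq_iff_eq_add, he'] at he
        rw [he]
        simp only [Algebra.smul_def]
        ring
      have hα := hG.1
      by_cases h1 : β ≤ i ∧ α ≤ j
      · obtain ⟨⟨i', rfl⟩, ⟨j', rfl⟩⟩ := And.intro (Nat.exists_eq_add_of_le h1.1)
          (Nat.exists_eq_add_of_le h1.2)
        exact hmulti _ _ i' j' hj (by ring) fun w hw => ih hw
      · by_cases h2 : i < β + b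
        · exact ⟨0, zero_mem _, _, Submodule.subset_span ⟨β, α, i, j, hG, h2, hj, h1, rfl⟩,
            by simp⟩
        · obtain ⟨i', rfl⟩ := Nat.exists_eq_add_of_le (not_lt.1 h2)
          have hjα : j < α := by
            by_contra hcon
            exact h1 ⟨by lia, not_lt.1 hcon⟩
          obtain ⟨d, hd⟩ := Nat.exists_eq_add_of_le (hα.le : α ≤ a)
          refine hmulti _ _ i' (d + j) hj ?_ fun w hw => ih hw
          have hab : b * a = b * α + b * d := by rw [← mul_add, ← hd]
          have hab' : a * b = b * a := mul_comm a b
          rw [mul_add, mul_add, mul_add]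
          lia

/-- The monomials that span the remainders have weight at most `D + a * b - a - b`. -/
theorem remainders_le_weightLT {Γ : Type*} [LinearOrderedCommGroupWithZero Γ]
    {v : Valuation C.FunField Γ} {γ : Γ} (hv : C.IsWeightValuation v γ) {G : C.FunField} {D : ℕ}
    (hG : v G = γ ^ D) : C.remainders G ≤ C.weightLT (D + (a - 1) * (b - 1)) := by
  refine Submodule.span_le.2 ?_
  rintro _ ⟨β, α, i, j, hlt, hi, hj, hij, rfl⟩
  have hD : a * β + b * α = D := by
    rw [hv.map_of_hasLeadingTerm hlt] at hG
    exact pow_right_injective₀ (zero_lt_one.trans hv.one_lt) hv.one_lt.ne' hG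
  refine Submodule.subset_span ⟨i, j, hj, ?_, rfl⟩
  have hα := hlt.1
  obtain ⟨a', rfl⟩ := Nat.exists_eq_add_of_lt C.a_pos
  obtain ⟨b', rfl⟩ := Nat.exists_eq_add_of_lt C.b_pos
  simp only [zero_add, Nat.add_sub_cancel] at *
  rw [← hD]
  rcases lt_or_ge i β with h | h
  · nlinarith [Nat.mul_le_mul_left (a' + 1) (Nat.succ_le_of_lt h),
      Nat.mul_le_mul_left (b' + 1) (Nat.le_of_lt_succ hj)]
  · have hjα : j < α := by
      by_contra hcon
      exact hij ⟨h, not_lt.1 hcon⟩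
    nlinarith [Nat.mul_le_mul_left (a' + 1) (Nat.le_of_lt_succ hi),
      Nat.mul_le_mul_left (b' + 1) (Nat.succ_le_of_lt hjα)]

theorem two_mul_genus (C : CabCurve K a b) : 2 * genus a b = (a - 1) * (b - 1) := by
  rw [genus]
  refine Nat.mul_div_cancel' ?_
  rcases Nat.even_or_odd a with ha | ha
  · rcases Nat.even_or_odd b with hb | hb
    · have := Nat.dvd_gcd ha.two_dvd hb.two_dvd
      rw [Nat.Coprime.gcd_eq_one C.coprime] at this
      lia
    · exact Dvd.dvd.mul_left (by obtain ⟨k, rfl⟩ := hb; simp) _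
  · exact Dvd.dvd.mul_right (by obtain ⟨k, rfl⟩ := ha; simp) _

end CabCurve

end

/-! ### Normality of the affine coordinate ring -/

/-- If `t` generates `F` over the fraction field `S` of the normal domain `A` and `p` is its minimal
polynomial over `A`, then `p'(t)` multiplies the integral closure of `A` in `F` into `A[t]`. -/
theorem aeval_derivative_minpoly_mul_mem_adjoin {A S F : Type*} [CommRing A] [IsDomain A]
    [IsIntegrallyClosed A] [Field S] [Algebra A S] [IsFractionRing A S] [Field F] [Algebra A F]
    [Algebra S F] [IsScalarTower A S F] {t : F} (ht : IsIntegral A t)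
    (hadj : Algebra.adjoin S {t} = ⊤) {z : F} (hz : IsIntegral A z) :
    Polynomial.aeval t (Polynomial.derivative (minpoly A t)) * z ∈ Algebra.adjoin A {t} := by
  have htS : IsIntegral S t := ht.tower_top
  have hmin : minpoly S t = (minpoly A t).map (algebraMap A S) :=
    minpoly.isIntegrallyClosed_eq_field_fractions' S ht
  let φ : S[X] →ₐ[A] F := (Polynomial.aeval t).restrictScalars A
  have hφ : Function.Surjective φ := by
    intro w
    have hw : w ∈ Algebra.adjoin S {t} := hadj ▸ Algebra.mem_top
    rw [Algebra.adjoin_singleton_eq_range_aeval] at hw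
    exact hw
  have hker : RingHom.ker φ.toRingHom = Ideal.span {minpoly S t} := by
    ext f
    rw [Ideal.mem_span_singleton, minpoly.dvd_iff]
    exact Iff.rfl
  obtain ⟨g, hg, hgi⟩ := exists_derivative_mul_eq_and_isIntegral_coeff (R := A) hφ
    (minpoly.monic htS) (fun i => by
      rw [hmin, Polynomial.coeff_map]; exact isIntegral_algebraMap) hker hz
  have hφa : ∀ f, φ f = Polynomial.aeval t f := fun _ => rfl
  rw [hφa, hφa, hmin, Polynomial.derivative_map, Polynomial.aeval_map_algebraMap] at hg
  rw [hg, Polynomial.aeval_eq_sum_range]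
  refine Subalgebra.sum_mem _ fun i _ => ?_
  obtain ⟨c, hc⟩ := IsIntegrallyClosed.isIntegral_iff.1 (hgi i)
  rw [← hc, algebraMap_smul S c]
  exact Subalgebra.smul_mem _ (Subalgebra.pow_mem _ (Algebra.self_mem_adjoin_singleton A t) i) c

open Polynomial in
/-- The bivariate form of the same fact: `∂p/∂Y (u, t)` multiplies the integral closure of
`K[u, t]` into `K[u, t]`, if `p` is irreducible and monic in `Y` up to a unit, and `p(u, t) = 0`.
The integral closure is taken as the intersection of the valuation rings that contain `K[u, t]`. -/
theorem aevalAeval_derivative_mul_mem_adjoin {K F : Type*} [Field K] [Field F] [Algebra K F]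
    {u t : F} (hu : Transcendental K u) (hF : ∀ z : F, ∃ r ∈ Algebra.adjoin K {u, t},
      ∃ w ∈ Algebra.adjoin K {u, t}, z = r / w) {p : K[X][X]} (hp : Irreducible p)
    (hlead : IsUnit p.leadingCoeff) (hroot : aevalAeval u t p = 0) {z : F}
    (hz : ∀ V : ValuationSubring F, (∀ w ∈ Algebra.adjoin K {u, t}, w ∈ V) → z ∈ V) :
    aevalAeval u t (derivative p) * z ∈ Algebra.adjoin K {u, t} := by
  let : Algebra K[X] F := (aeval u : K[X] →ₐ[K] F).toRingHom.toAlgebra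
  have halg : ∀ f : K[X], algebraMap K[X] F f = aeval u f := fun f => rfl
  have : IsScalarTower K K[X] F := IsScalarTower.of_algebraMap_eq fun c => by
    rw [halg, algebraMap_eq, aeval_C]
  have hinj : Function.Injective (algebraMap K[X] F) := transcendental_iff_injective.1 hu
  have : FaithfulSMul K[X] F := (faithfulSMul_iff_algebraMap_injective _ _).2 hinj
  let : Algebra (FractionRing K[X]) F := FractionRing.liftAlgebra K[X] F
  have : IsScalarTower K[X] (FractionRing K[X]) F := FractionRing.isScalarTower_liftAlgebra _ _
  have hev : ∀ f : K[X][X], aevalAeval u t f = aeval t f := fun f => by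
    induction f using Polynomial.induction_on' with
    | add f g hf hg => rw [map_add, map_add, hf, hg]
    | monomial n f => simp [aeval_monomial, halg]
  have hadjK : ∀ B : Subring F, (∀ f : K[X], algebraMap K[X] F f ∈ B) → t ∈ B →
      ∀ w ∈ Algebra.adjoin K {u, t}, w ∈ B := by
    intro B hB ht w hw
    induction hw using Algebra.adjoin_induction with
    | mem z hz =>
      rcases hz with rfl | rfl
      · simpa [halg] using hB X
      · exact ht
    | algebraMap c => simpa [halg] using hB (C c)
    | add z w _ _ hz hw => exact add_mem hz hw
    | mul z w _ _ hz hw => exact mul_mem hz hw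
  obtain ⟨c, hc⟩ := hlead
  have hmonic : (C (↑c⁻¹ : K[X]) * p).Monic := by
    rw [Monic, leadingCoeff_mul, leadingCoeff_C, ← hc, Units.inv_mul]
  have hzero : aeval t (C (↑c⁻¹ : K[X]) * p) = 0 := by
    rw [← hev, map_mul, hroot, mul_zero]
  have ht : IsIntegral K[X] t := ⟨_, hmonic, hzero⟩
  have hassoc : ∃ d : K[X], p = C d * minpoly K[X] t := by
    have hdvd : minpoly K[X] t ∣ p :=
      minpoly.isIntegrallyClosed_dvd ht (by rw [← hev, hroot])
    obtain ⟨e, he⟩ := hdvd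
    rcases hp.isUnit_or_isUnit he with h | h
    · exact absurd h (minpoly.not_isUnit _ _)
    · obtain ⟨d, -, rfl⟩ := Polynomial.isUnit_iff.1 h
      exact ⟨d, by rw [mul_comm, ← he]⟩
  have hadj : Algebra.adjoin (FractionRing K[X]) {t} = ⊤ := by
    have htS : IsIntegral (FractionRing K[X]) t := ht.tower_top
    rw [← IntermediateField.adjoin_simple_toSubalgebra_of_isAlgebraic htS.isAlgebraic,
      eq_top_iff]
    rintro w -
    have hsub := hadjK
      (IntermediateField.adjoin (FractionRing K[X]) {t}).toSubalgebra.toSubring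
      (fun f => by
        rw [IsScalarTower.algebraMap_apply K[X] (FractionRing K[X]) F]
        exact IntermediateField.algebraMap_mem _ _)
      (IntermediateField.mem_adjoin_simple_self _ t)
    obtain ⟨r, hr, s, hs, rfl⟩ := hF w
    exact IntermediateField.div_mem _ (hsub r hr) (hsub s hs)
  have hz' : IsIntegral K[X] z := by
    change z ∈ (integralClosure K[X] F).toSubring
    rw [Subring.eq_iInf_of_isIntegrallyClosedIn (R := (integralClosure K[X] F).toSubring),
      Subring.mem_iInf]
    rintro ⟨V, hV⟩
    exact hz V (hadjK V.toSubring (fun f => hV (isIntegral_algebraMap (x := f))) (hV ht))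
  obtain ⟨d, hd⟩ := hassoc
  have key := aeval_derivative_minpoly_mul_mem_adjoin (S := FractionRing K[X]) ht hadj hz'
  rw [Algebra.adjoin_singleton_eq_range_aeval] at key
  obtain ⟨f, hf⟩ := key
  have e : aevalAeval u t (derivative p) * z = aevalAeval u t (C d * f) := by
    have hf' : aeval t f = aeval t (derivative (minpoly K[X] t)) * z := hf
    rw [hev, hev, hd, derivative_C_mul, map_mul, map_mul, hf', mul_assoc]
  rw [e]
  exact aevalAeval_mem_adjoin u t _

open Polynomial in
theorem Polynomial.coeff_coeff_swap {R : Type*} [CommRing R] (p : R[X][X]) (i j : ℕ) :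
    ((Bivariate.swap p).coeff i).coeff j = (p.coeff j).coeff i := by
  induction p using Polynomial.induction_on' with
  | add p q hp hq => simp [hp, hq]
  | monomial n p =>
    induction p using Polynomial.induction_on' with
    | add p q hp hq => simp only [map_add, coeff_add, hp, hq]
    | monomial m c =>
      rw [Bivariate.swap_monomial_monomial]
      simp only [coeff_monomial]
      split_ifs <;> simp_all [coeff_monomial]

/-- Weak Nullstellensatz for two variables. -/
theorem Polynomial.exists_aevalAeval_eq_zero {K : Type*} [Field K] {I : Ideal K[X][X]}
    (hI : I ≠ ⊤) : ∃ x y : AlgebraicClosure K, ∀ p ∈ I, Polynomial.aevalAeval x y p = 0 := by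
  obtain ⟨M, hM, hIM⟩ := Ideal.exists_le_maximal I hI
  let := Ideal.Quotient.field M
  have : Algebra.FiniteType K K[X][X] :=
    Algebra.FiniteType.trans (S := K[X]) inferInstance inferInstance
  have : Module.Finite K (K[X][X] ⧸ M) := finite_of_finite_type_of_isJacobsonRing K _
  let ψ : K[X][X] →ₐ[K] AlgebraicClosure K :=
    (IsAlgClosed.lift : (K[X][X] ⧸ M) →ₐ[K] AlgebraicClosure K).comp (Ideal.Quotient.mkₐ K M)
  obtain ⟨⟨x, y⟩, hxy⟩ := (Polynomial.aevalAevalEquiv K (AlgebraicClosure K)).surjective ψ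
  refine ⟨x, y, fun p hp => ?_⟩
  change Polynomial.aevalAevalEquiv K (AlgebraicClosure K) (x, y) p = 0
  rw [hxy]
  have : Ideal.Quotient.mkₐ K M p = 0 := Ideal.Quotient.eq_zero_iff_mem.2 (hIM hp)
  simp only [ψ, AlgHom.comp_apply, this, map_zero]

namespace CabCurve

variable {K : Type*} [Field K] {a b : ℕ} (C : CabCurve K a b)

theorem isUnit_leadingCoeff_poly : IsUnit C.poly.leadingCoeff := by
  have hcoeff : ∀ j, a < j → C.poly.coeff j = 0 := by
    intro j hj
    ext i
    by_contra h
    have hab : a * b ≤ b * j := by rw [mul_comm]; exact Nat.mul_le_mul_left b hj.le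
    rcases C.coeff_other i j h with h | h | h <;> lia
  have hne : C.poly.coeff a ≠ 0 := fun h => C.coeff_y (by rw [h, Polynomial.coeff_zero])
  have hdeg : C.poly.natDegree = a :=
    le_antisymm (Polynomial.natDegree_le_iff_coeff_eq_zero.2 hcoeff)
      (Polynomial.le_natDegree_of_ne_zero hne)
  have hC : C.poly.coeff a = Polynomial.C ((C.poly.coeff a).coeff 0) := by
    ext i
    rw [Polynomial.coeff_C]
    split_ifs with hi
    · rw [hi]
    by_contra h
    have hab : a * b = b * a := mul_comm a b
    have ha := C.a_pos
    rcases C.coeff_other i a h with h | h | h <;> lia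
  rw [Polynomial.leadingCoeff, hdeg, hC]
  exact Polynomial.isUnit_C.2 (isUnit_iff_ne_zero.2 C.coeff_y)

theorem isUnit_leadingCoeff_swap_poly : IsUnit (Polynomial.Bivariate.swap C.poly).leadingCoeff := by
  have hcoeff : ∀ j, b < j → (Polynomial.Bivariate.swap C.poly).coeff j = 0 := by
    intro j hj
    ext i
    rw [Polynomial.coeff_coeff_swap]
    by_contra h
    have hab : a * b ≤ a * j := Nat.mul_le_mul_left a hj.le
    rcases C.coeff_other j i h with h | h | h <;> lia
  have hne : (Polynomial.Bivariate.swap C.poly).coeff b ≠ 0 := fun h => C.coeff_x (by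
    rw [← Polynomial.coeff_coeff_swap, h, Polynomial.coeff_zero])
  have hdeg : (Polynomial.Bivariate.swap C.poly).natDegree = b :=
    le_antisymm (Polynomial.natDegree_le_iff_coeff_eq_zero.2 hcoeff)
      (Polynomial.le_natDegree_of_ne_zero hne)
  have hC : (Polynomial.Bivariate.swap C.poly).coeff b =
      Polynomial.C ((C.poly.coeff 0).coeff b) := by
    ext i
    rw [Polynomial.coeff_C, Polynomial.coeff_coeff_swap]
    split_ifs with hi
    · rw [hi]
    by_contra h
    have hb := C.b_pos
    rcases C.coeff_other b i h with h | h | h <;> lia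
  rw [Polynomial.leadingCoeff, hdeg, hC]
  exact Polynomial.isUnit_C.2 (isUnit_iff_ne_zero.2 C.coeff_x)

/-- The two partial derivatives generate the unit ideal of the affine ring. -/
theorem exists_mul_partial_add_mul_partial_eq_one :
    ∃ u ∈ C.affineRing, ∃ w ∈ C.affineRing,
      u * Polynomial.aevalAeval C.x C.y (Polynomial.derivative C.poly) +
        w * Polynomial.aevalAeval C.y C.x
          (Polynomial.derivative (Polynomial.Bivariate.swap C.poly)) = 1 := by
  set px := Polynomial.Bivariate.swap (Polynomial.derivative (Polynomial.Bivariate.swap C.poly))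
    with hpx
  have htop : Ideal.span {C.poly, Polynomial.derivative C.poly, px} = ⊤ := by
    by_contra hne
    obtain ⟨x₀, y₀, h⟩ := Polynomial.exists_aevalAeval_eq_zero hne
    have hmap : ∀ p : K[X][X], (p.map (Polynomial.mapRingHom
        (algebraMap K (AlgebraicClosure K)))).evalEval x₀ y₀ =
        Polynomial.aevalAeval x₀ y₀ p := by
      intro p
      induction p using Polynomial.induction_on' with
      | add p q hp hq => simp only [Polynomial.map_add, Polynomial.evalEval_add, hp, hq, map_add]
      | monomial n p => simp [Polynomial.evalEval, Polynomial.aeval_def, Polynomial.eval_map]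
    have hmapx : ∀ p : K[X][X], (Polynomial.derivative ((p.map (Polynomial.mapRingHom
        (algebraMap K (AlgebraicClosure K)))).eval (Polynomial.C y₀))).eval x₀ =
        Polynomial.aevalAeval y₀ x₀ (Polynomial.derivative (Polynomial.Bivariate.swap p)) := by
      intro p
      induction p using Polynomial.induction_on' with
      | add p q hp hq =>
        simp only [Polynomial.map_add, Polynomial.eval_add, hp, hq, map_add]
      | monomial n p =>
        induction p using Polynomial.induction_on' with
        | add p q hp hq =>
          simp only [map_add, Polynomial.map_add, Polynomial.eval_add, hp, hq]
        | monomial i c =>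
          rw [Polynomial.Bivariate.swap_monomial_monomial]
          rw [Polynomial.map_monomial, Polynomial.eval_monomial, ← Polynomial.C_pow,
            Polynomial.derivative_mul, Polynomial.derivative_C]
          simp [Polynomial.derivative_monomial]
          ring
    have h0 := h C.poly (Ideal.subset_span (by simp))
    have h1 := h _ (Ideal.subset_span (by simp) :
      Polynomial.derivative C.poly ∈ Ideal.span {C.poly, Polynomial.derivative C.poly, px})
    have h2 := h px (Ideal.subset_span (by simp))
    rw [hpx, Polynomial.Bivariate.aevalAeval_swap] at h2
    rcases C.nonsingular x₀ y₀ (by rw [hmap, h0]) with hn | hn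
    · exact hn (by rw [hmapx, h2])
    · exact hn (by rw [Polynomial.derivative_map, hmap, h1])
  have h1 : (1 : K[X][X]) ∈ Ideal.span {C.poly, Polynomial.derivative C.poly, px} := by
    rw [htop]; trivial
  obtain ⟨p₁, q, hq, h1⟩ := Ideal.mem_span_insert.1 h1
  obtain ⟨p₂, p₃, rfl⟩ := Ideal.mem_span_pair.1 hq
  refine ⟨_, C.aevalAeval_mem_affineRing p₂, _, C.aevalAeval_mem_affineRing p₃, ?_⟩
  have := congrArg (Polynomial.aevalAeval C.x C.y) h1
  rw [map_add, map_add, map_mul, map_mul, map_mul, aevalAeval_poly, mul_zero, zero_add, map_one,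
    hpx, Polynomial.Bivariate.aevalAeval_swap] at this
  exact this.symm

variable {C}

/-- The affine ring of a nonsingular curve is normal: a function that lies in all valuation rings
containing it is regular. -/
theorem mem_affineRing_of_forall_valuationSubring {P : Place K C.FunField}
    (hP : C.IsAtInfinity P) {z : C.FunField}
    (hz : ∀ V : ValuationSubring C.FunField, (∀ w ∈ C.affineRing, w ∈ V) → z ∈ V) :
    z ∈ C.affineRing := by
  obtain ⟨γ, hγ, -⟩ := hP.exists_isWeightValuation
  -- an element algebraic over `K` lies in every valuation ring that contains `K`
  have htrans : ∀ {u : C.FunField} {n : ℕ}, P.ring.valuation u = γ ^ n → 0 < n →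
      Transcendental K u := by
    intro u n hu hn halg
    have hint : IsIntegral P.ring u := by
      obtain ⟨p, hp, hp0⟩ := halg.isIntegral
      let ι : K →+* P.ring := (algebraMap K C.FunField).codRestrict P.ring.toSubring P.const_mem
      refine ⟨p.map ι, hp.map ι, ?_⟩
      rw [Polynomial.eval₂_map]
      exact hp0
    obtain ⟨w, hw⟩ := IsIntegrallyClosed.isIntegral_iff.1 hint
    have h1 := (P.ring.valuation_le_one_iff u).2 (hw ▸ w.2)
    rw [hu] at h1
    exact absurd h1 (not_le.2 (one_lt_pow₀ hγ.one_lt hn.ne'))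
  have hF : ∀ z : C.FunField, ∃ r ∈ C.affineRing, ∃ w ∈ C.affineRing, z = r / w := by
    intro z
    obtain ⟨r, hr, w, hw, -, h⟩ := C.exists_div_eq z
    exact ⟨r, hr, w, hw, h⟩
  have hswap : Algebra.adjoin K {C.y, C.x} = C.affineRing := by
    rw [Set.pair_comm]; rfl
  have hy := aevalAeval_derivative_mul_mem_adjoin (htrans hγ.map_x C.a_pos) hF C.irreducible
    C.isUnit_leadingCoeff_poly C.aevalAeval_poly hz
  have hx := aevalAeval_derivative_mul_mem_adjoin (htrans hγ.map_y C.b_pos) (by rwa [hswap])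
    ((MulEquiv.irreducible_iff Polynomial.Bivariate.swap).2 C.irreducible)
    C.isUnit_leadingCoeff_swap_poly
    (by rw [Polynomial.Bivariate.aevalAeval_swap, C.aevalAeval_poly]) (by rwa [hswap])
  rw [hswap] at hx
  obtain ⟨u, hu, w, hw, h1⟩ := C.exists_mul_partial_add_mul_partial_eq_one
  have e : z = u * (Polynomial.aevalAeval C.x C.y (Polynomial.derivative C.poly) * z) +
      w * (Polynomial.aevalAeval C.y C.x
        (Polynomial.derivative (Polynomial.Bivariate.swap C.poly)) * z) := by
    linear_combination (-z) * h1
  rw [e]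
  exact add_mem (mul_mem hu hy) (mul_mem hw hx)

/-- `L(n P∞)` consists of the regular functions of weighted degree at most `n`. -/
theorem mem_onePoint_iff {P : Place K C.FunField} (hP : C.IsAtInfinity P) (n : ℕ)
    {f : C.FunField} : f ∈ C.onePoint P n ↔ f ∈ C.weightLT (n + 1) := by
  obtain ⟨γ, hγ, t, ht⟩ := hP.exists_isWeightValuation
  have hord := ordGE_neg_natCast_iff_of_isAtInfinity hγ ht f n
  constructor
  · rintro (rfl | h)
    · exact zero_mem _
    have hf : f ∈ C.affineRing := by
      refine mem_affineRing_of_forall_valuationSubring hP fun V hV => ?_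
      by_cases hVtop : V = ⊤
      · rw [hVtop]; exact ValuationSubring.mem_top f
      let Q : Place K C.FunField := ⟨V, fun c => hV _ (Subalgebra.algebraMap_mem _ c), hVtop⟩
      have hQ : Q ≠ P := by
        rintro rfl
        exact hP ⟨hV _ C.x_mem_affineRing, hV _ C.y_mem_affineRing⟩
      have := h Q
      rw [Finsupp.single_eq_of_ne hQ, neg_zero] at this
      exact (Place.ordGE_zero_iff Q f).1 this
    have hv := h P
    rw [Finsupp.single_eq_same, hord] at hv
    exact (hγ.mem_weightLT_iff hf).2 (hv.trans_lt (pow_lt_pow_right₀ hγ.one_lt n.lt_succ_self))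
  · intro hf
    right
    intro Q
    by_cases hQ : Q = P
    · subst hQ
      rw [Finsupp.single_eq_same, hord]
      exact hγ.le_of_mem_weightLT_succ hf
    · rw [Finsupp.single_eq_of_ne hQ, neg_zero, Place.ordGE_zero_iff]
      exact affineRing_le_of_not_isAtInfinity (fun h => hQ (h.unique hP))
        (C.weightLT_le_affineRing _ hf)

end CabCurve

/-! ### Trace codes -/

/-- The trace is invariant under the Frobenius automorphism over the base field. -/
theorem FiniteField.algebraTrace_pow_card {k K : Type*} [Field k] [Finite k] [Field K] [Finite K]
    [Algebra k K] {q : ℕ} (hq : Nat.card k = q) (z : K) :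
    Algebra.trace k K (z ^ q) = Algebra.trace k K z := by
  have := Fintype.ofFinite k
  have := Module.Finite.of_finite (R := k) (M := K)
  rw [← hq, Nat.card_eq_fintype_card]
  exact Algebra.trace_eq_of_algEquiv (FiniteField.frobeniusAlgEquivOfAlgebraic k K) z

namespace CabCurve

variable {k K : Type*} [Field k] [Field K] [Algebra k K] {a b : ℕ}
  {C : CabCurve K a b}

/-- Weighted division of the numerator by `g ^ (q ^ (i + 1) - q ^ i + 1)`, read on traces. -/
theorem exists_trace_eval_eq_add {Γ : Type*} [LinearOrderedCommGroupWithZero Γ]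
    {v : Valuation C.FunField Γ} {γ : Γ} (hv : C.IsWeightValuation v γ)
    {g : C.FunField} (hg : g ∈ C.affineRing) {d : ℕ} (hgd : v g = γ ^ d)
    {pts : Set (Place K C.FunField)} (hrat : ∀ P ∈ pts, P.IsRational)
    (haff : ∀ P ∈ pts, ¬ C.IsAtInfinity P) (hinv : ∀ P ∈ pts, g⁻¹ ∈ P.ring)
    {q : ℕ} (hq : 1 < q) (i : ℕ) {n : ℕ} {z : C.FunField} (hz : z ∈ C.weightLT n) :
    ∃ A ∈ C.weightLT (n - d * (q ^ (i + 1) - q ^ i + 1)),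
      ∃ r ∈ C.remainders (g ^ (q ^ (i + 1) - q ^ i + 1)), ∀ P ∈ pts,
        Algebra.trace k K (P.eval ((g ^ (q ^ (i + 1) + 1))⁻¹ * z)) =
          Algebra.trace k K (P.eval ((g ^ q ^ i)⁻¹ * A)) +
            Algebra.trace k K (P.eval ((g ^ (q ^ (i + 1) + 1))⁻¹ * r)) := by
  set N := q ^ (i + 1) - q ^ i + 1 with hN
  have hNq : N + q ^ i = q ^ (i + 1) + 1 := by
    have := Nat.pow_le_pow_right (zero_lt_one.trans hq) (Nat.le_succ i)
    lia
  have hg0 : g ≠ 0 := by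
    rintro rfl
    rw [map_zero] at hgd
    exact pow_ne_zero d hv.ne_zero hgd.symm
  obtain ⟨M, hM⟩ := C.exists_mem_weightLT (pow_mem hg N)
  obtain ⟨β, α, hlt, -⟩ := C.exists_hasLeadingTerm hM (pow_ne_zero N hg0)
  have hD : a * β + b * α = d * N := by
    have h := hv.map_of_hasLeadingTerm hlt
    rw [map_pow, hgd, ← pow_mul] at h
    exact (pow_right_injective₀ (zero_lt_one.trans hv.one_lt) hv.one_lt.ne' h).symm
  obtain ⟨A, hA, r, hr, rfl⟩ := exists_eq_mul_add_remainder hv hlt hz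
  rw [hD] at hA
  refine ⟨A, hA, r, hr, fun P hP => ?_⟩
  have hreg : ∀ w ∈ C.affineRing, w ∈ P.ring :=
    fun w => affineRing_le_of_not_isAtInfinity (haff P hP)
  have hAR : A ∈ P.ring := hreg _ (C.weightLT_le_affineRing _ hA)
  have hrR : r ∈ P.ring := hreg _ (C.weightLT_le_affineRing _ (remainders_le_weightLT hv
    (by rw [map_pow, hgd, ← pow_mul]) hr))
  have hinv' : ∀ j, (g ^ j)⁻¹ ∈ P.ring := fun j => by
    rw [← inv_pow]; exact pow_mem (hinv P hP) j
  have e : (g ^ (q ^ (i + 1) + 1))⁻¹ * (g ^ N * A + r) =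
      (g ^ q ^ i)⁻¹ * A + (g ^ (q ^ (i + 1) + 1))⁻¹ * r := by
    rw [← hNq, pow_add]
    field_simp
  rw [e, (hrat P hP).eval_add (mul_mem (hinv' _) hAR) (mul_mem (hinv' _) hrR), map_add]

/-- Traces of functions with denominator `g ^ (q ^ i)` and numerator of weight below that of
`g ^ (q ^ i)` are traces with denominator `g ^ (q ^ (i + 1) + 1)` and a remainder as numerator.
By Frobenius, `A / g ^ (q ^ i)` has the traces of `A ^ q * g / g ^ (q ^ (i + 1) + 1)`; division
returns a function `A₁ / g ^ (q ^ i)`, and the gap `d * q ^ i - deg A` grows by a factor of at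
least `q`. -/
theorem exists_remainder_trace_eval_eq [Finite k] [Finite K]
    {Γ : Type*} [LinearOrderedCommGroupWithZero Γ] {v : Valuation C.FunField Γ} {γ : Γ} (hv : C.IsWeightValuation v γ)
    {g : C.FunField} (hg : g ∈ C.affineRing) {d : ℕ} (hgd : v g = γ ^ d)
    {pts : Set (Place K C.FunField)} (hrat : ∀ P ∈ pts, P.IsRational)
    (haff : ∀ P ∈ pts, ¬ C.IsAtInfinity P) (hinv : ∀ P ∈ pts, g⁻¹ ∈ P.ring)
    {q : ℕ} (hq : Nat.card k = q) (i : ℕ) {n : ℕ} (hn : n ≤ d * q ^ i) {A : C.FunField}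
    (hA : A ∈ C.weightLT n) :
    ∃ h ∈ C.remainders (g ^ (q ^ (i + 1) - q ^ i + 1)), ∀ P ∈ pts,
      Algebra.trace k K (P.eval ((g ^ q ^ i)⁻¹ * A)) =
        Algebra.trace k K (P.eval ((g ^ (q ^ (i + 1) + 1))⁻¹ * h)) := by
  have hq1 : 1 < q := hq ▸ Finite.one_lt_card
  have hg0 : g ≠ 0 := by
    rintro rfl
    rw [map_zero] at hgd
    exact pow_ne_zero d hv.ne_zero hgd.symm
  induction n using Nat.strong_induction_on generalizing A with
  | _ n ih =>
  rcases n with _ | n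
  · rw [weightLT_zero, Submodule.mem_bot] at hA
    exact ⟨0, zero_mem _, fun P _ => by rw [hA, mul_zero, mul_zero]⟩
  have hAR : A ∈ C.affineRing := C.weightLT_le_affineRing _ hA
  have hz : A ^ q * g ∈ C.weightLT (n * q + d + 1) := by
    rw [hv.mem_weightLT_iff (mul_mem (pow_mem hAR q) hg), map_mul, map_pow, hgd]
    calc v A ^ q * γ ^ d ≤ (γ ^ n) ^ q * γ ^ d :=
          mul_le_mul' (pow_le_pow_left' (hv.le_of_mem_weightLT_succ hA) q) le_rfl
      _ = γ ^ (n * q + d) := by rw [← pow_mul, ← pow_add]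
      _ < γ ^ (n * q + d + 1) := pow_lt_pow_right₀ hv.one_lt (Nat.lt_succ_self _)
  obtain ⟨A₁, hA₁, r, hr, htr⟩ :=
    exists_trace_eval_eq_add (k := k) hv hg hgd hrat haff hinv hq1 i hz
  have hdec : n * q + d + 1 - d * (q ^ (i + 1) - q ^ i + 1) ≤ n := by
    obtain ⟨p, rfl⟩ := Nat.exists_eq_add_of_le hq1
    have e : (1 + 1 + p) ^ (i + 1) - (1 + 1 + p) ^ i = (1 + p) * (1 + 1 + p) ^ i := by
      rw [pow_succ, Nat.sub_eq_iff_eq_add (Nat.le_mul_of_pos_right _ (by lia))]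
      ring
    rw [e, Nat.sub_le_iff_le_add]
    nlinarith [Nat.mul_le_mul_left (1 + p) hn]
  obtain ⟨h, hh, hh'⟩ := ih _ (Nat.lt_succ_of_le hdec) (by lia) hA₁
  refine ⟨h + r, add_mem hh hr, fun P hP => ?_⟩
  have hreg : ∀ w ∈ C.affineRing, w ∈ P.ring :=
    fun w => affineRing_le_of_not_isAtInfinity (haff P hP)
  have hinv' : ∀ j, (g ^ j)⁻¹ ∈ P.ring := fun j => by
    rw [← inv_pow]; exact pow_mem (hinv P hP) j
  have hremR : ∀ w ∈ C.remainders (g ^ (q ^ (i + 1) - q ^ i + 1)), w ∈ P.ring := fun w hw =>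
    hreg _ (C.weightLT_le_affineRing _ (remainders_le_weightLT hv
      (by rw [map_pow, hgd, ← pow_mul]) hw))
  have e : ((g ^ q ^ i)⁻¹ * A) ^ q = (g ^ (q ^ (i + 1) + 1))⁻¹ * (A ^ q * g) := by
    rw [mul_pow, inv_pow, ← pow_mul, ← pow_succ, pow_succ g]
    field_simp
  rw [← FiniteField.algebraTrace_pow_card hq,
    ← (hrat P hP).eval_pow (mul_mem (hinv' _) (hreg _ hAR)), e, htr P hP, hh' P hP, mul_add,
    (hrat P hP).eval_add (mul_mem (hinv' _) (hremR h hh)) (mul_mem (hinv' _) (hremR r hr)),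
    map_add]

end CabCurve

theorem mainTheorem3 {k K : Type*} [Field k] [Finite k] [Field K] [Finite K] [Algebra k K]
    (q m : ℕ) (hq : Nat.card k = q) (hm : Module.finrank k K = m)
    {a b : ℕ} (C : CabCurve K a b)
    (Pinf : Place K C.FunField) (hPinf : C.IsAtInfinity Pinf)
    (s s' : ℤ) (hss' : s < s')
    (g : C.FunField) (hg : g ∈ C.onePoint Pinf s') (hgdeg : C.HasWeightedDegree g s')
    (pts : Set (Place K C.FunField)) (hrat : ∀ P ∈ pts, P.IsRational)
    (hsupp : pts ∩ Place.support K g = ∅)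
    (istar : ℕ)
    (histar : IsLeast {i : ℕ | i < m / 2 ∧
      s * (q : ℤ) ^ i ≥ (s' - s) * ((q : ℤ) ^ (i + 1) - (q : ℤ) ^ i + 1)
        + 2 * (CabCurve.genus a b : ℤ) - 1} istar) :
    ∀ i : ℕ, istar ≤ i → i < m / 2 →
      C.T k Pinf pts q s g i ⊆ C.T k Pinf pts q s g (i + 1) := by
  intro i hi _
  have hq1 : 1 < q := hq ▸ Finite.one_lt_card
  have hq1' : (1 : ℤ) < q := by exact_mod_cast hq1
  have hstar := histar.1.2
  set E : ℤ := (q : ℤ) ^ istar with hE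
  have hE1 : 1 ≤ E := one_le_pow₀ hq1'.le
  rw [pow_succ, ← hE] at hstar
  have hQ : 0 ≤ E * q - E := by nlinarith
  have hγ0 : (0 : ℤ) ≤ CabCurve.genus a b := Int.natCast_nonneg _
  have hδ : 1 ≤ s' - s := by lia
  -- the numerical condition forces `s ≥ 0`, so `g` has a pole at infinity
  have hs : 0 ≤ s := by
    by_contra! hneg
    nlinarith [mul_nonneg (sub_nonneg.2 hδ) hQ]
  -- the numerical condition passes from `istar` to `i`
  have hcond : s * (q : ℤ) ^ i ≥ (s' - s) * ((q : ℤ) ^ (i + 1) - (q : ℤ) ^ i + 1)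
      + 2 * (CabCurve.genus a b : ℤ) - 1 := by
    obtain ⟨j, rfl⟩ := Nat.exists_eq_add_of_le hi
    have ht : 1 ≤ (q : ℤ) ^ j := one_le_pow₀ hq1'.le
    rw [pow_succ, pow_add, ← hE]
    set t := (q : ℤ) ^ j
    have h1 := mul_le_mul_of_nonneg_right hstar (zero_le_one.trans ht)
    have h2 : 0 ≤ (t - 1) * ((s' - s) + 2 * (CabCurve.genus a b : ℤ) - 1) :=
      mul_nonneg (by lia) (by lia)
    linarith
  obtain ⟨β, α, hlt, hd⟩ := hgdeg
  set d := a * β + b * α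
  obtain ⟨σ, rfl⟩ := Int.eq_ofNat_of_zero_le hs
  subst hd
  have hσd : σ < d := by exact_mod_cast hss'
  obtain ⟨γ, hv, -⟩ := hPinf.exists_isWeightValuation
  have hgd : Pinf.ring.valuation g = γ ^ d := hv.map_of_hasLeadingTerm hlt
  have hgR : g ∈ C.affineRing := C.weightLT_le_affineRing _ hlt.mem_weightLT
  have hg0 : g ≠ 0 := by
    rintro rfl
    rw [map_zero] at hgd
    exact pow_ne_zero d hv.ne_zero hgd.symm
  have hunit : ∀ P ∈ pts, g ∈ P.ring ∧ g⁻¹ ∈ P.ring := by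
    intro P hP
    by_contra h
    have : P ∈ pts ∩ Place.support K g := ⟨hP, h⟩
    rw [hsupp] at this
    exact this
  have haff : ∀ P ∈ pts, ¬ C.IsAtInfinity P := by
    intro P hP hinf
    obtain rfl := hinf.unique hPinf
    have := (P.ring.valuation_le_one_iff g).2 (hunit P hP).1
    rw [hgd] at this
    exact absurd this (not_le.2 (one_lt_pow₀ hv.one_lt (by lia)))
  have hinv : ∀ P ∈ pts, g⁻¹ ∈ P.ring := fun P hP => (hunit P hP).2
  have hqi : q ^ i ≤ q ^ (i + 1) := Nat.pow_le_pow_right (zero_lt_one.trans hq1) (Nat.le_succ i)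
  set N := q ^ (i + 1) - q ^ i + 1 with hN
  have hNq : N + q ^ i = q ^ (i + 1) + 1 := by lia
  have hgN : Pinf.ring.valuation (g ^ N) = γ ^ (d * N) := by rw [map_pow, hgd, ← pow_mul]
  rintro _ ⟨_, ⟨f, hf, rfl⟩, rfl⟩
  have hfL : f ∈ C.onePoint Pinf ((σ * (q ^ i + 1) : ℕ) : ℤ) := by
    rcases i with _ | i
    · have e : ((σ * (q ^ 0 + 1) : ℕ) : ℤ) = 2 * σ := by push_cast; ring
      rw [e]
      exact hf
    · have e : ((σ * (q ^ (i + 1) + 1) : ℕ) : ℤ) = σ * ((q : ℤ) ^ (i + 1) + 1) := by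
        push_cast; ring
      rw [e]
      exact hf.2
  rw [CabCurve.mem_onePoint_iff hPinf] at hfL
  have hfR : f ∈ C.affineRing := C.weightLT_le_affineRing _ hfL
  have hz : f * g ^ (q ^ (i + 1) - q ^ i) ∈
      C.weightLT (σ * (q ^ i + 1) + d * (q ^ (i + 1) - q ^ i) + 1) := by
    rw [hv.mem_weightLT_iff (mul_mem hfR (pow_mem hgR _)), map_mul, map_pow, hgd]
    calc _ ≤ γ ^ (σ * (q ^ i + 1)) * (γ ^ d) ^ (q ^ (i + 1) - q ^ i) :=
          mul_le_mul' (hv.le_of_mem_weightLT_succ hfL) le_rfl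
      _ = γ ^ (σ * (q ^ i + 1) + d * (q ^ (i + 1) - q ^ i)) := by rw [← pow_mul, ← pow_add]
      _ < _ := pow_lt_pow_right₀ hv.one_lt (Nat.lt_succ_self _)
  obtain ⟨A, hA, r, hr, htr⟩ :=
    CabCurve.exists_trace_eval_eq_add (k := k) hv hgR hgd hrat haff hinv hq1 i hz
  have hle : σ * (q ^ i + 1) + d * (q ^ (i + 1) - q ^ i) + 1 - d * (q ^ (i + 1) - q ^ i + 1) ≤
      d * q ^ i := by
    rw [Nat.sub_le_iff_le_add]
    have h1 : (σ + 1) * (q ^ i + 1) ≤ d * (q ^ i + 1) := Nat.mul_le_mul_right _ hσd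
    generalize q ^ (i + 1) - q ^ i = M
    generalize q ^ i = X at h1 ⊢
    linarith
  obtain ⟨h, hh, hh'⟩ :=
    CabCurve.exists_remainder_trace_eval_eq hv hgR hgd hrat haff hinv hq i hle hA
  -- by the numerical condition all remainders lie in the required Riemann-Roch space
  have hremL : ∀ w ∈ C.remainders (g ^ N), w ∈ C.onePoint Pinf (σ * ((q : ℤ) ^ (i + 1) + 1)) := by
    intro w hw
    have e : (σ * ((q : ℤ) ^ (i + 1) + 1)) = ((σ * (q ^ (i + 1) + 1) : ℕ) : ℤ) := by
      push_cast; ring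
    rw [e, CabCurve.mem_onePoint_iff hPinf]
    refine C.weightLT_mono ?_ (CabCurve.remainders_le_weightLT hv hgN hw)
    rw [← CabCurve.two_mul_genus C, ← Nat.cast_le (α := ℤ)]
    have hNZ : (N : ℤ) = (q : ℤ) ^ (i + 1) - (q : ℤ) ^ i + 1 := by
      rw [hN]; push_cast [hqi]; ring
    push_cast
    rw [← hNZ] at hcond
    have : (q : ℤ) ^ (i + 1) + 1 = N + (q : ℤ) ^ i := by rw [hNZ]; ring
    rw [this]
    linarith
  refine ⟨_, ⟨h + r, ⟨add_mem hh hr, hremL _ (add_mem hh hr)⟩, rfl⟩, funext fun P => ?_⟩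
  have hP := P.2
  have hreg : ∀ w ∈ C.affineRing, w ∈ P.1.ring :=
    fun w => CabCurve.affineRing_le_of_not_isAtInfinity (haff P hP)
  have hinv' : ∀ j, (g ^ j)⁻¹ ∈ P.1.ring := fun j => by
    rw [← inv_pow]; exact pow_mem (hinv P hP) j
  have hremR : ∀ w ∈ C.remainders (g ^ N), w ∈ P.1.ring := fun w hw =>
    hreg _ (C.weightLT_le_affineRing _ (CabCurve.remainders_le_weightLT hv hgN hw))
  have e : (g ^ (q ^ i + 1))⁻¹ * f =
      (g ^ (q ^ (i + 1) + 1))⁻¹ * (f * g ^ (q ^ (i + 1) - q ^ i)) := by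
    have : q ^ (i + 1) + 1 = (q ^ i + 1) + (q ^ (i + 1) - q ^ i) := by lia
    rw [this, pow_add g (q ^ i + 1)]
    field_simp
  rw [e, htr P hP, hh' P hP, mul_add, (hrat P hP).eval_add (mul_mem (hinv' _) (hremR h hh))
    (mul_mem (hinv' _) (hremR r hr)), map_add]
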